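/- **Setting.** Let $(\Omega,\Sigma,\mu)$ be a measure space and $\mathcal A\subseteq\Sigma$ a sub-$\sigma$-algebra on which $\mu$ is $\sigma$-finite. For measurable $f:\Omega\to[0,\infty]$ let $E(f):\Omega\to[0,\infty]$ be the $\mathcal A$-measurable function, unique up to null sets, with $\int_A E(f)\,d\mu=\int_A f\,d\mu$ for all $A\in\mathcal A$. A measurable $f:\Omega\to\mathbb C$ has a conditional expectation if $E(|f|)<\infty$ a.e.; then $E(f)$ is obtained from the positive and negative parts of $\operatorname{Re} f$ and $\operatorname{Im} f$ by linearity. A *Young function* is a continuous, convex, even $\Phi:\mathbb R\to[0,\infty)$ with $\Phi(x)=0$ if and only if $x=0$, and $\Phi(x)/x\to\infty$ as $x\to\infty$. A Young function $\Psi$ is *complementary* to $\Phi$ if $\Psi(y)=\sup\{x|y|-\Phi(x):x\ge 0\}$ for all $y\in\mathbb R$. Write $\Phi\in\Delta'$ (globally) if there is $c>0$ with $\Phi(xy)\le c\,\Phi(x)\Phi(y)$ for all $x,y\ge0$. For complex $z$ put $\Phi(z)=\Phi(|z|)$, and let $\Phi^{-1}:[0,\infty]\to[0,\infty]$ be the inverse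 of $\Phi|_{[0,\infty)}$, with $\Phi^{-1}(\infty)=\infty$. The Orlicz space $L^\Phi(\Sigma)$ consists of the measurable $f:\Omega\to\mathbb C$ (modulo a.e. equality) such that $\int_\Omega\Phi(kf)\,d\mu<\infty$ for some $k>0$, with the norm $N_\Phi(f)=\inf\{k>0:\int_\Omega\Phi(f/k)\,d\mu\le1\}$. The *generalized conditional Hölder inequality* holds for $(E,\Phi)$, with complementary function $\Psi$, if there is $C>0$ such that for all $f\in L^\Phi(\Sigma)$, $g\in L^\Psi(\Sigma)$, $$E(|fg|)\le C\,\Phi^{-1}\big(E(\Phi(|f|))\big)\,\Psi^{-1}\big(E(\Psi(|g|))\big)\quad\text{a.e.}\qquad(0\cdot\infty=0).$$ An *$\mathcal A$-atom* is a set $A\in\mathcal A$ with $\mu(A)>0$ such that every $F\in\mathcal A$ with $F\subseteq A$ satisfies $\mu(F)=0$ or $\mu(F)=\mu(A)$. A set *consists of finitely many $\mathcal A$-atoms* if, up to a $\mu$-null set, it is the union of a finite (possibly empty) family of pairwise disjoint $\mathcal A$-atoms. **Theorem 2.3.** Let $\Phi$ be a Young function and $u:\Omega\to\mathbb C$ a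 measurable function such that $uf$ has a conditional expectation for every $f\in L^\Phi(\Sigma)$ and $T=EM_u$, $Tf=E(uf)$, is a bounded operator on $L^\Phi(\Sigma)$. (a) If $T$ is compact, then for every $\varepsilon>0$ the set $\{x:|E(u)(x)|\ge\varepsilon\}$ consists of finitely many $\mathcal A$-atoms, and so does $\{x:E(u)(x)\text{ is real and }E(u)(x)\ge\varepsilon\}$. Let moreover $\Psi$ be a Young function complementary to $\Phi$. (b) If $T$ is compact and $\Phi\in\Delta'$ globally, then for every $\varepsilon>0$ the set $\{x:\Psi^{-1}(E(\Psi(u)))(x)\ge\varepsilon\}$ consists of finitely many $\mathcal A$-atoms. (c) If $(E,\Phi)$ satisfies the generalized conditional Hölder inequality and $\{x:\Psi^{-1}(E(\Psi(u)))(x)\ge\varepsilon\}$ consists of finitely many $\mathcal A$-atoms for every $\varepsilon>0$, then $T$ is compact; moreover, $T$ is a limit in operator norm of bounded finite-rank operators on $L^\Phi(\Sigma)$. -/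

import Mathlib

open MeasureTheory Set Filter Topology
open scoped ENNReal NNReal

/-- A Young function: a continuous, convex, even function `Φ : ℝ → [0, ∞)` which vanishes exactly
at `0` and satisfies `Φ x / x → ∞` and `Φ x → ∞` as `x → ∞`. -/
structure YoungFunction where
  toFun : ℝ → ℝ
  nonneg' : ∀ x, 0 ≤ toFun x
  continuous' : Continuous toFun
  convex' : ConvexOn ℝ univ toFun
  eq_zero_iff' : ∀ x, toFun x = 0 ↔ x = 0
  even' : ∀ x, toFun (-x) = toFun x
  tendsto_div' : Tendsto (fun x => toFun x / x) atTop atTop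
  tendsto' : Tendsto toFun atTop atTop

namespace YoungFunction

instance : CoeFun YoungFunction (fun _ => ℝ → ℝ) := ⟨YoungFunction.toFun⟩

/-- `Ψ` is the complementary Young function of `Φ`: `Ψ y = sup {x |y| - Φ x : x ≥ 0}`. (The set is
non-empty, and it is bounded above since `Φ x / x → ∞`.) -/
def IsComplementary (Φ Ψ : YoungFunction) : Prop :=
  ∀ y : ℝ, Ψ y = sSup ((fun x : ℝ => x * |y| - Φ x) '' Ici 0)

/-- The condition `Δ'`, globally: `Φ (x y) ≤ c Φ(x) Φ(y)` for all `x, y ≥ 0`, for some `c > 0`. -/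
def DeltaPrime (Φ : YoungFunction) : Prop :=
  ∃ c : ℝ, 0 < c ∧ ∀ x y : ℝ, 0 ≤ x → 0 ≤ y → Φ (x * y) ≤ c * Φ x * Φ y

/-- The function `Φ(|z|)`, with values in `[0, ∞]`. -/
noncomputable def eval (Φ : YoungFunction) (z : ℂ) : ℝ≥0∞ := ENNReal.ofReal (Φ ‖z‖)

/-- The inverse `Φ⁻¹ : [0, ∞] → [0, ∞]` of the bijection `Φ : [0, ∞) → [0, ∞)`, extended by
`Φ⁻¹(∞) = ∞` (the infimum is then over the empty set). -/
noncomputable def inv (Φ : YoungFunction) (t : ℝ≥0∞) : ℝ≥0∞ :=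
  ⨅ (x : ℝ≥0) (_ : t ≤ ENNReal.ofReal (Φ x)), (x : ℝ≥0∞)

theorem map_zero (Φ : YoungFunction) : Φ 0 = 0 := (Φ.eq_zero_iff' 0).2 rfl

theorem map_mul_le (Φ : YoungFunction) {a : ℝ} (ha : 0 ≤ a) (ha1 : a ≤ 1) (t : ℝ) :
    Φ (a * t) ≤ a * Φ t := by
  have h := Φ.convex'.2 (mem_univ t) (mem_univ 0) ha (sub_nonneg.2 ha1) (by ring)
  simpa [Φ.map_zero] using h

theorem mono (Φ : YoungFunction) {s t : ℝ} (hs : 0 ≤ s) (hst : s ≤ t) : Φ s ≤ Φ t := by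
  rcases hs.eq_or_lt with rfl | hs
  · rw [Φ.map_zero]; exact Φ.nonneg' t
  have ht : 0 < t := hs.trans_le hst
  have h := Φ.map_mul_le (div_nonneg hs.le ht.le) ((div_le_one ht).2 hst) t
  rw [div_mul_cancel₀ s ht.ne'] at h
  exact h.trans (mul_le_of_le_one_left (Φ.nonneg' t) ((div_le_one ht).2 hst))

theorem strictMono (Φ : YoungFunction) {s t : ℝ} (hs : 0 ≤ s) (hst : s < t) : Φ s < Φ t := by
  have ht : 0 < t := hs.trans_lt hst
  have hpos : 0 < Φ t := lt_of_le_of_ne (Φ.nonneg' t)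
    (fun h => ht.ne' ((Φ.eq_zero_iff' t).1 h.symm))
  have h := Φ.map_mul_le (div_nonneg hs ht.le) ((div_le_one ht).2 hst.le) t
  rw [div_mul_cancel₀ s ht.ne'] at h
  exact h.trans_lt (mul_lt_of_lt_one_left hpos ((div_lt_one ht).2 hst))

/-- `inv` is the inverse of `Φ` on `[0, ∞)`. -/
theorem inv_apply (Φ : YoungFunction) (x : ℝ≥0) : Φ.inv (ENNReal.ofReal (Φ x)) = x := by
  apply le_antisymm
  · exact iInf₂_le (f := fun (y : ℝ≥0) (_ : ENNReal.ofReal (Φ x) ≤ ENNReal.ofReal (Φ y)) =>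
      (y : ℝ≥0∞)) x le_rfl
  · refine le_iInf₂ fun y hy => ?_
    rw [ENNReal.ofReal_le_ofReal_iff (Φ.nonneg' _)] at hy
    by_contra h
    have h' : y < x := by simpa using h
    exact absurd hy (not_le.2 (Φ.strictMono y.2 (by exact_mod_cast h')))

theorem inv_top (Φ : YoungFunction) : Φ.inv ∞ = ∞ := by simp [inv]

end YoungFunction

section Orlicz

variable {Ω : Type*} [MeasurableSpace Ω] {μ : Measure Ω}

/-- `f` belongs to the Orlicz class `L^Φ`: `f` is measurable and `∫ Φ(k |f|) dμ < ∞` for some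
`k > 0`. -/
def MemOrlicz (Φ : YoungFunction) (μ : Measure Ω) (f : Ω → ℂ) : Prop :=
  AEStronglyMeasurable f μ ∧ ∃ k : ℝ, 0 < k ∧ ∫⁻ x, Φ.eval (k * f x) ∂μ < ∞

/-- The set of all `k > 0` with `∫ Φ(|f| / k) dμ ≤ 1`. -/
def luxemburgSet (Φ : YoungFunction) (μ : Measure Ω) (f : Ω → ℂ) : Set ℝ :=
  {k : ℝ | 0 < k ∧ ∫⁻ x, Φ.eval (f x / k) ∂μ ≤ 1}

/-- The Luxemburg norm `N_Φ(f) = inf {k > 0 : ∫ Φ(|f| / k) dμ ≤ 1}`. -/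
noncomputable def luxemburgNorm (Φ : YoungFunction) (μ : Measure Ω) (f : Ω → ℂ) : ℝ :=
  sInf (luxemburgSet Φ μ f)

theorem YoungFunction.aemeasurable_eval (Φ : YoungFunction) {f : Ω → ℂ}
    (hf : AEStronglyMeasurable f μ) : AEMeasurable (fun x => Φ.eval (f x)) μ :=
  (Φ.continuous'.measurable.comp_aemeasurable hf.norm.aemeasurable).ennreal_ofReal

theorem YoungFunction.eval_mono (Φ : YoungFunction) {z w : ℂ} (h : ‖z‖ ≤ ‖w‖) :
    Φ.eval z ≤ Φ.eval w :=
  ENNReal.ofReal_le_ofReal (Φ.mono (norm_nonneg z) h)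

theorem YoungFunction.eval_smul_le (Φ : YoungFunction) {a : ℝ} (ha : 0 ≤ a) (ha1 : a ≤ 1) (z : ℂ) :
    Φ.eval (a * z) ≤ ENNReal.ofReal a * Φ.eval z := by
  unfold YoungFunction.eval
  rw [← ENNReal.ofReal_mul ha, norm_mul, Complex.norm_real, Real.norm_of_nonneg ha]
  exact ENNReal.ofReal_le_ofReal (Φ.map_mul_le ha ha1 _)

theorem luxemburgSet_bddBelow (Φ : YoungFunction) (μ : Measure Ω) (f : Ω → ℂ) :
    BddBelow (luxemburgSet Φ μ f) := ⟨0, fun _ hk => hk.1.le⟩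

theorem luxemburgNorm_nonneg (Φ : YoungFunction) (μ : Measure Ω) (f : Ω → ℂ) :
    0 ≤ luxemburgNorm Φ μ f := Real.sInf_nonneg fun _ hk => hk.1.le

theorem luxemburgSet_congr (Φ : YoungFunction) {f g : Ω → ℂ} (h : f =ᵐ[μ] g) :
    luxemburgSet Φ μ f = luxemburgSet Φ μ g := by
  ext k
  have : ∫⁻ x, Φ.eval (f x / k) ∂μ = ∫⁻ x, Φ.eval (g x / k) ∂μ :=
    lintegral_congr_ae (h.mono fun x hx => by simp only [hx])
  simp only [luxemburgSet, Set.mem_ofPred_eq, this]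

theorem luxemburgNorm_congr (Φ : YoungFunction) {f g : Ω → ℂ} (h : f =ᵐ[μ] g) :
    luxemburgNorm Φ μ f = luxemburgNorm Φ μ g := by
  rw [luxemburgNorm, luxemburgSet_congr Φ h, luxemburgNorm]

theorem luxemburgSet_up (Φ : YoungFunction) {f : Ω → ℂ} {k l : ℝ} (hk : k ∈ luxemburgSet Φ μ f)
    (hkl : k ≤ l) : l ∈ luxemburgSet Φ μ f := by
  refine ⟨hk.1.trans_le hkl, (lintegral_mono fun x => Φ.eval_mono ?_).trans hk.2⟩
  have h1 := hk.1
  have h2 : 0 < l := hk.1.trans_le hkl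
  rw [norm_div, norm_div, Complex.norm_real, Complex.norm_real, Real.norm_of_nonneg h1.le,
    Real.norm_of_nonneg h2.le]
  gcongr

theorem luxemburgSet_nonempty {Φ : YoungFunction} {f : Ω → ℂ} (hf : MemOrlicz Φ μ f) :
    (luxemburgSet Φ μ f).Nonempty := by
  obtain ⟨-, k, hk, hfin⟩ := hf
  set M := (∫⁻ x, Φ.eval (k * f x) ∂μ).toReal with hM
  have hM0 : 0 ≤ M := ENNReal.toReal_nonneg
  have hn : 0 < M + 1 := by positivity
  refine ⟨(M + 1) / k, by positivity, ?_⟩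
  have key : ∀ x, Φ.eval (f x / ((M + 1) / k : ℝ)) ≤
      ENNReal.ofReal (M + 1)⁻¹ * Φ.eval (k * f x) := by
    intro x
    have h := Φ.eval_smul_le (a := (M + 1)⁻¹) (by positivity)
      (inv_le_one_of_one_le₀ (by linarith)) (k * f x)
    refine le_of_eq_of_le ?_ h
    congr 1
    push_cast
    field_simp
  calc ∫⁻ x, Φ.eval (f x / ((M + 1) / k : ℝ)) ∂μ
      ≤ ∫⁻ x, ENNReal.ofReal (M + 1)⁻¹ * Φ.eval (k * f x) ∂μ := lintegral_mono key
    _ = ENNReal.ofReal (M + 1)⁻¹ * ∫⁻ x, Φ.eval (k * f x) ∂μ :=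
        lintegral_const_mul' _ _ ENNReal.ofReal_ne_top
    _ = ENNReal.ofReal ((M + 1)⁻¹ * M) := by
        rw [ENNReal.ofReal_mul (by positivity), hM, ENNReal.ofReal_toReal hfin.ne]
    _ ≤ 1 := by
        rw [ENNReal.ofReal_le_one, inv_mul_le_one₀ hn]
        linarith

theorem memOrlicz_of_mem {Φ : YoungFunction} {f : Ω → ℂ} (hf : AEStronglyMeasurable f μ) {k : ℝ}
    (hk : k ∈ luxemburgSet Φ μ f) : MemOrlicz Φ μ f := by
  refine ⟨hf, k⁻¹, inv_pos.2 hk.1, ?_⟩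
  refine lt_of_le_of_lt (le_of_eq ?_) (hk.2.trans_lt ENNReal.one_lt_top)
  refine lintegral_congr fun x => ?_
  rw [Complex.ofReal_inv, div_eq_inv_mul]

theorem luxemburgSet_add {Φ : YoungFunction} {f g : Ω → ℂ} (hf : AEStronglyMeasurable f μ)
    {k l : ℝ} (hk : k ∈ luxemburgSet Φ μ f) (hl : l ∈ luxemburgSet Φ μ g) :
    k + l ∈ luxemburgSet Φ μ (f + g) := by
  have hk0 := hk.1
  have hl0 := hl.1
  have hkl : 0 < k + l := by linarith
  refine ⟨hkl, ?_⟩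
  have key : ∀ x, Φ.eval ((f + g) x / ((k + l : ℝ) : ℂ)) ≤
      ENNReal.ofReal (k / (k + l)) * Φ.eval (f x / k) +
        ENNReal.ofReal (l / (k + l)) * Φ.eval (g x / l) := by
    intro x
    unfold YoungFunction.eval
    rw [← ENNReal.ofReal_mul (by positivity), ← ENNReal.ofReal_mul (by positivity),
      ← ENNReal.ofReal_add (mul_nonneg (by positivity) (Φ.nonneg' _))
        (mul_nonneg (by positivity) (Φ.nonneg' _))]
    apply ENNReal.ofReal_le_ofReal
    have hc := Φ.convex'.2 (mem_univ ‖f x / (k : ℂ)‖) (mem_univ ‖g x / (l : ℂ)‖)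
      (show 0 ≤ k / (k + l) by positivity) (show 0 ≤ l / (k + l) by positivity) (by field_simp)
    refine le_trans (Φ.mono (norm_nonneg _) ?_) hc
    simp only [norm_div, Complex.norm_real, Real.norm_of_nonneg hk0.le, Real.norm_of_nonneg hl0.le,
      Real.norm_of_nonneg hkl.le, smul_eq_mul, Pi.add_apply]
    have h2 : k / (k + l) * (‖f x‖ / k) + l / (k + l) * (‖g x‖ / l) = (‖f x‖ + ‖g x‖) / (k + l) := by
      field_simp
    rw [h2]
    gcongr
    exact norm_add_le _ _
  have hm : AEMeasurable (fun x => ENNReal.ofReal (k / (k + l)) * Φ.eval (f x / k)) μ :=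
    (Φ.aemeasurable_eval (by simpa only [div_eq_mul_inv] using hf.mul_const _)).const_mul _
  calc ∫⁻ x, Φ.eval ((f + g) x / ((k + l : ℝ) : ℂ)) ∂μ
      ≤ ∫⁻ x, (ENNReal.ofReal (k / (k + l)) * Φ.eval (f x / k) +
        ENNReal.ofReal (l / (k + l)) * Φ.eval (g x / l)) ∂μ := lintegral_mono key
    _ = ENNReal.ofReal (k / (k + l)) * ∫⁻ x, Φ.eval (f x / k) ∂μ +
        ENNReal.ofReal (l / (k + l)) * ∫⁻ x, Φ.eval (g x / l) ∂μ := by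
        rw [lintegral_add_left' hm, lintegral_const_mul' _ _ ENNReal.ofReal_ne_top,
          lintegral_const_mul' _ _ ENNReal.ofReal_ne_top]
    _ ≤ ENNReal.ofReal (k / (k + l)) * 1 + ENNReal.ofReal (l / (k + l)) * 1 := by
        gcongr
        · exact hk.2
        · exact hl.2
    _ = 1 := by
        rw [mul_one, mul_one, ← ENNReal.ofReal_add (by positivity) (by positivity), ← add_div,
          div_self hkl.ne', ENNReal.ofReal_one]

theorem luxemburgSet_smul {Φ : YoungFunction} {f : Ω → ℂ} {c : ℂ} (hc : c ≠ 0) {k : ℝ}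
    (hk : k ∈ luxemburgSet Φ μ f) : ‖c‖ * k ∈ luxemburgSet Φ μ (c • f) := by
  have hc0 : 0 < ‖c‖ := norm_pos_iff.2 hc
  have hk0 := hk.1
  refine ⟨by positivity, (lintegral_mono fun x => Φ.eval_mono (le_of_eq ?_)).trans hk.2⟩
  simp only [Pi.smul_apply, smul_eq_mul, norm_div, norm_mul, Complex.norm_real, norm_norm]
  field_simp

theorem luxemburgNorm_zero (Φ : YoungFunction) (μ : Measure Ω) : luxemburgNorm Φ μ 0 = 0 := by
  refine le_antisymm ?_ (luxemburgNorm_nonneg _ _ _)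
  refine le_of_forall_pos_le_add fun ε hε => ?_
  rw [zero_add]
  refine csInf_le (luxemburgSet_bddBelow _ _ _) ⟨hε, ?_⟩
  simp [YoungFunction.eval, Φ.map_zero]

theorem luxemburgNorm_add_le {Φ : YoungFunction} {f g : Ω → ℂ} (hf : MemOrlicz Φ μ f)
    (hg : MemOrlicz Φ μ g) :
    luxemburgNorm Φ μ (f + g) ≤ luxemburgNorm Φ μ f + luxemburgNorm Φ μ g := by
  refine le_of_forall_pos_le_add fun ε hε => ?_
  obtain ⟨k, hk, hk'⟩ := exists_lt_of_csInf_lt (luxemburgSet_nonempty hf)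
    (lt_add_of_pos_right (luxemburgNorm Φ μ f) (half_pos hε))
  obtain ⟨l, hl, hl'⟩ := exists_lt_of_csInf_lt (luxemburgSet_nonempty hg)
    (lt_add_of_pos_right (luxemburgNorm Φ μ g) (half_pos hε))
  have := csInf_le (luxemburgSet_bddBelow Φ μ (f + g)) (luxemburgSet_add hf.1 hk hl)
  change luxemburgNorm Φ μ (f + g) ≤ k + l at this
  linarith

theorem luxemburgNorm_smul_le {Φ : YoungFunction} {f : Ω → ℂ} (hf : MemOrlicz Φ μ f) (c : ℂ) :
    luxemburgNorm Φ μ (c • f) ≤ ‖c‖ * luxemburgNorm Φ μ f := by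
  rcases eq_or_ne c 0 with rfl | hc
  · simp [luxemburgNorm_zero]
  have hc0 : 0 < ‖c‖ := norm_pos_iff.2 hc
  rw [← div_le_iff₀' hc0]
  refine le_csInf (luxemburgSet_nonempty hf) fun k hk => ?_
  rw [div_le_iff₀' hc0]
  exact csInf_le (luxemburgSet_bddBelow _ _ _) (luxemburgSet_smul hc hk)

theorem ae_eq_zero_of_luxemburgNorm_eq_zero {Φ : YoungFunction} {f : Ω → ℂ}
    (hf : MemOrlicz Φ μ f) (h : luxemburgNorm Φ μ f = 0) : f =ᵐ[μ] 0 := by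
  have hall : ∀ k : ℝ, 0 < k → k ∈ luxemburgSet Φ μ f := fun k hk => by
    obtain ⟨l, hl, hlk⟩ := exists_lt_of_csInf_lt (luxemburgSet_nonempty hf)
      (show luxemburgNorm Φ μ f < k by rw [h]; exact hk)
    exact luxemburgSet_up Φ hl hlk.le
  have hle : ∀ a : ℝ, 0 < a → a ≤ 1 → ∫⁻ x, Φ.eval (f x) ∂μ ≤ ENNReal.ofReal a := by
    intro a ha ha1
    calc ∫⁻ x, Φ.eval (f x) ∂μ
        ≤ ∫⁻ x, ENNReal.ofReal a * Φ.eval (f x / a) ∂μ := by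
          refine lintegral_mono fun x => ?_
          have h1 := Φ.eval_smul_le ha.le ha1 (f x / a)
          have ha' : (a : ℂ) ≠ 0 := by exact_mod_cast ha.ne'
          rwa [mul_div_cancel₀ _ ha'] at h1
      _ = ENNReal.ofReal a * ∫⁻ x, Φ.eval (f x / a) ∂μ :=
          lintegral_const_mul' _ _ ENNReal.ofReal_ne_top
      _ ≤ ENNReal.ofReal a * 1 := by
          gcongr
          exact (hall a ha).2
      _ = ENNReal.ofReal a := mul_one _
  have hzero : ∫⁻ x, Φ.eval (f x) ∂μ = 0 := by
    refine le_antisymm (le_of_forall_gt fun b hb => ?_) zero_le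
    rcases eq_or_ne b ∞ with rfl | hb'
    · exact (hle 1 one_pos le_rfl).trans_lt ENNReal.ofReal_lt_top
    have hb0 : 0 < b.toReal := ENNReal.toReal_pos hb.ne' hb'
    refine (hle (min 1 (b.toReal / 2)) (by positivity) (min_le_left _ _)).trans_lt ?_
    rw [ENNReal.ofReal_lt_iff_lt_toReal (by positivity) hb']
    exact (min_le_right _ _).trans_lt (half_lt_self hb0)
  rw [lintegral_eq_zero_iff' (Φ.aemeasurable_eval hf.1)] at hzero
  filter_upwards [hzero] with x hx
  have h0 : Φ ‖f x‖ = 0 :=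
    le_antisymm (by simpa [YoungFunction.eval] using hx) (Φ.nonneg' _)
  simpa using (Φ.eq_zero_iff' _).1 h0

theorem MemOrlicz.congr {Φ : YoungFunction} {f g : Ω → ℂ} (hf : MemOrlicz Φ μ f)
    (h : f =ᵐ[μ] g) : MemOrlicz Φ μ g := by
  obtain ⟨k, hk⟩ := luxemburgSet_nonempty hf
  exact memOrlicz_of_mem (hf.1.congr h) (luxemburgSet_congr Φ h ▸ hk)

theorem MemOrlicz.add {Φ : YoungFunction} {f g : Ω → ℂ} (hf : MemOrlicz Φ μ f)
    (hg : MemOrlicz Φ μ g) : MemOrlicz Φ μ (f + g) := by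
  obtain ⟨k, hk⟩ := luxemburgSet_nonempty hf
  obtain ⟨l, hl⟩ := luxemburgSet_nonempty hg
  exact memOrlicz_of_mem (hf.1.add hg.1) (luxemburgSet_add hf.1 hk hl)

theorem MemOrlicz.zero (Φ : YoungFunction) : MemOrlicz Φ μ 0 :=
  ⟨aestronglyMeasurable_zero, 1, one_pos, by simp [YoungFunction.eval, Φ.map_zero]⟩

theorem MemOrlicz.const_smul {Φ : YoungFunction} {f : Ω → ℂ} (hf : MemOrlicz Φ μ f) (c : ℂ) :
    MemOrlicz Φ μ (c • f) := by
  rcases eq_or_ne c 0 with rfl | hc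
  · rw [zero_smul]; exact MemOrlicz.zero Φ
  obtain ⟨k, hk⟩ := luxemburgSet_nonempty hf
  exact memOrlicz_of_mem (hf.1.const_smul c) (luxemburgSet_smul hc hk)

/-- The Orlicz space `L^Φ(μ)` of (classes modulo a.e. equality of) complex functions. -/
noncomputable def OrliczSpace (Φ : YoungFunction) (μ : Measure Ω) : Submodule ℂ (Ω →ₘ[μ] ℂ) where
  carrier := {f | MemOrlicz Φ μ f}
  add_mem' {f g} hf hg := MemOrlicz.congr (MemOrlicz.add hf hg) (AEEqFun.coeFn_add f g).symm
  zero_mem' := MemOrlicz.congr (MemOrlicz.zero Φ) AEEqFun.coeFn_zero.symm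
  smul_mem' c f hf := MemOrlicz.congr (MemOrlicz.const_smul hf c) (AEEqFun.coeFn_smul c f).symm

/-- The Orlicz space is normed by the Luxemburg norm. -/
noncomputable instance OrliczSpace.instNormedAddCommGroup (Φ : YoungFunction) (μ : Measure Ω) :
    NormedAddCommGroup (OrliczSpace Φ μ) :=
  AddGroupNorm.toNormedAddCommGroup
    { toFun := fun f => luxemburgNorm Φ μ (f : Ω →ₘ[μ] ℂ)
      map_zero' := (luxemburgNorm_congr Φ AEEqFun.coeFn_zero).trans (luxemburgNorm_zero Φ μ)
      add_le' := fun f g =>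
        (luxemburgNorm_congr Φ (AEEqFun.coeFn_add _ _)).trans_le (luxemburgNorm_add_le f.2 g.2)
      neg' := fun f => by
        refine (luxemburgNorm_congr Φ (AEEqFun.coeFn_neg _)).trans ?_
        simp only [luxemburgNorm, luxemburgSet, YoungFunction.eval, Pi.neg_apply, neg_div, norm_neg]
      eq_zero_of_map_eq_zero' := fun f hf => by
        refine Subtype.ext (AEEqFun.ext ?_)
        exact (ae_eq_zero_of_luxemburgNorm_eq_zero f.2 hf).trans AEEqFun.coeFn_zero.symm }

theorem OrliczSpace.norm_def {Φ : YoungFunction} (f : OrliczSpace Φ μ) :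
    ‖f‖ = luxemburgNorm Φ μ (f : Ω →ₘ[μ] ℂ) := rfl

noncomputable instance OrliczSpace.instNormedSpace (Φ : YoungFunction) (μ : Measure Ω) :
    NormedSpace ℂ (OrliczSpace Φ μ) where
  norm_smul_le c f :=
    (luxemburgNorm_congr Φ (AEEqFun.coeFn_smul c _)).trans_le (luxemburgNorm_smul_le f.2 c)

end Orlicz

section CondExp

variable {Ω : Type*}

/-- `f` has a conditional expectation with respect to `𝒜`: it is measurable and `E(|f|) < ∞` a.e.
Here `E` of a `[0, ∞]`-valued function is `condLExp`. For `μ` σ-finite on `𝒜`, this includes all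
`f ∈ L¹ + L^∞`. -/
def Conditionable (𝒜 : MeasurableSpace Ω) [MeasurableSpace Ω] (μ : Measure Ω) (f : Ω → ℂ) : Prop :=
  AEStronglyMeasurable f μ ∧ ∀ᵐ x ∂μ, condLExp 𝒜 μ (fun x => ‖f x‖ₑ) x < ∞

/-- The conditional expectation `E(f)` of a complex function: the combination of the conditional
expectations of the positive and negative parts of its real and imaginary parts. -/
noncomputable def condE (𝒜 : MeasurableSpace Ω) [MeasurableSpace Ω] (μ : Measure Ω) (f : Ω → ℂ) :
    Ω → ℂ := fun x =>
  ⟨(condLExp 𝒜 μ (fun x => ENNReal.ofReal (f x).re) x).toReal -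
      (condLExp 𝒜 μ (fun x => ENNReal.ofReal (-(f x).re)) x).toReal,
    (condLExp 𝒜 μ (fun x => ENNReal.ofReal (f x).im) x).toReal -
      (condLExp 𝒜 μ (fun x => ENNReal.ofReal (-(f x).im)) x).toReal⟩

/-- `T` is the operator `E M_u` on `L^Φ(μ)`: for every `f ∈ L^Φ(μ)`, `E(u f)` is well defined and
`T f = E(u f)` a.e. -/
def IsCondMul (𝒜 : MeasurableSpace Ω) [MeasurableSpace Ω] {μ : Measure Ω} {Φ : YoungFunction}
    (u : Ω → ℂ) (T : OrliczSpace Φ μ →L[ℂ] OrliczSpace Φ μ) : Prop :=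
  ∀ f : OrliczSpace Φ μ, Conditionable 𝒜 μ (fun x => u x * (f : Ω →ₘ[μ] ℂ) x) ∧
    ((T f : Ω →ₘ[μ] ℂ) : Ω → ℂ) =ᵐ[μ] condE 𝒜 μ (fun x => u x * (f : Ω →ₘ[μ] ℂ) x)

/-- The function `Ψ⁻¹(E(Ψ(|u|)))`, with values in `[0, ∞]`. -/
noncomputable def invCondYoung (𝒜 : MeasurableSpace Ω) [MeasurableSpace Ω] (μ : Measure Ω)
    (Ψ : YoungFunction) (u : Ω → ℂ) : Ω → ℝ≥0∞ :=
  fun x => Ψ.inv (condLExp 𝒜 μ (fun x => Ψ.eval (u x)) x)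

/-- The generalized conditional Hölder inequality:
`E(|f g|) ≤ C Φ⁻¹(E(Φ(|f|))) Ψ⁻¹(E(Ψ(|g|)))` a.e., for all `f ∈ L^Φ`, `g ∈ L^Ψ`. -/
def CondHolder (𝒜 : MeasurableSpace Ω) [MeasurableSpace Ω] (μ : Measure Ω)
    (Φ Ψ : YoungFunction) : Prop :=
  ∃ C : ℝ≥0, 0 < C ∧ ∀ f g : Ω → ℂ, MemOrlicz Φ μ f → MemOrlicz Ψ μ g →
    ∀ᵐ x ∂μ, condLExp 𝒜 μ (fun x => ‖f x * g x‖ₑ) x ≤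
      C * invCondYoung 𝒜 μ Φ f x * invCondYoung 𝒜 μ Ψ g x

/-- `A` is an `𝒜`-atom of `μ`. -/
def IsMeasureAtom (𝒜 : MeasurableSpace Ω) [MeasurableSpace Ω] (μ : Measure Ω) (A : Set Ω) : Prop :=
  MeasurableSet[𝒜] A ∧ 0 < μ A ∧
    ∀ F : Set Ω, MeasurableSet[𝒜] F → F ⊆ A → μ F = 0 ∨ μ F = μ A

/-- `N` consists of finitely many `𝒜`-atoms: up to a `μ`-null set, it is the union of a finite
(possibly empty) family of pairwise disjoint `𝒜`-atoms. -/
def ConsistsOfFinitelyManyAtoms (𝒜 : MeasurableSpace Ω) [MeasurableSpace Ω] (μ : Measure Ω)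
    (N : Set Ω) : Prop :=
  ∃ (n : ℕ) (A : Fin n → Set Ω), (∀ i, IsMeasureAtom 𝒜 μ (A i)) ∧
    Pairwise (Function.onFun Disjoint A) ∧ N =ᵐ[μ] ⋃ i, A i

end CondExp

/-! Necessity, parts (a) and (b). The operator `T = E M_u` respects `𝒜`-measurable supports: if `f`
vanishes off `A ∈ 𝒜`, so does `T f`. If a set `N ∈ 𝒜` does not consist of finitely many atoms, it
contains infinitely many disjoint `𝒜`-sets of positive finite measure. Suppose each of them carries
an `f` in the unit ball with `‖T f‖ ≥ η`. The images have disjoint supports, so their mutual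
distances are at least `η`, which is impossible for compact `T`. It remains to find the test
functions. For (a), normalized indicators serve, since `T` multiplies `1_A` by `E(u)`. For (b), the
building block is `F = Φ⁻¹(Ψ(|u|))`, with `u` truncated, times the conjugate phase of `u` and a
normalizing constant `t`. Near-equality in Young's inequality gives `Ψ(|u|) ≤ F |u|`, so `T f` is at
least `t E(Ψ(u))`. `Δ'` bounds the modular of `f` above and that of `T f` below, uniformly in `A`
(`exists_test_function`).

Sufficiency, part (c). Let `N` be the set where `Ψ⁻¹(E(Ψ(u))) ≥ ε`. Off `N`, conditional Hölder
gives `|T f| ≤ 2Cε Φ⁻¹(E(Φ(f)))`. Applying `Φ` and integrating yields `‖T - 1_N T‖ ≤ 2Cε`. On `N`,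
the `𝒜`-measurable function `T f` is constant on each of finitely many atoms, so `1_N T` has finite
rank. Completeness of `L^Φ` then makes the norm limit `T` compact. -/

namespace YoungFunction

/-! ### Inverses and inequalities for Young functions. -/

theorem exists_eq (Φ : YoungFunction) {t : ℝ} (ht : 0 ≤ t) : ∃ x : ℝ≥0, Φ x = t := by
  obtain ⟨b, hb0, hb⟩ := ((eventually_ge_atTop (0 : ℝ)).and
    (Φ.tendsto'.eventually_ge_atTop t)).exists
  obtain ⟨x, hx, hxt⟩ := intermediate_value_Icc hb0 Φ.continuous'.continuousOn
    (show t ∈ Icc (Φ 0) (Φ b) from ⟨by rwa [Φ.map_zero], hb⟩)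
  exact ⟨⟨x, hx.1⟩, hxt⟩

theorem pos (Φ : YoungFunction) {x : ℝ} (hx : 0 < x) : 0 < Φ x := by
  simpa [Φ.map_zero] using Φ.strictMono le_rfl hx

theorem map_le_map_iff (Φ : YoungFunction) {x y : ℝ} (hx : 0 ≤ x) (hy : 0 ≤ y) :
    Φ x ≤ Φ y ↔ x ≤ y := by
  refine ⟨fun h => ?_, Φ.mono hx⟩
  by_contra! h'
  exact absurd h (not_le.2 (Φ.strictMono hy h'))

theorem ofReal_le_ofReal_iff (Φ : YoungFunction) {x y : ℝ≥0} :
    ENNReal.ofReal (Φ x) ≤ ENNReal.ofReal (Φ y) ↔ x ≤ y := by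
  rw [ENNReal.ofReal_le_ofReal_iff (Φ.nonneg' _), Φ.map_le_map_iff x.coe_nonneg y.coe_nonneg,
    NNReal.coe_le_coe]

theorem exists_ofReal_eq (Φ : YoungFunction) {t : ℝ≥0∞} (ht : t ≠ ∞) :
    ∃ x : ℝ≥0, ENNReal.ofReal (Φ x) = t := by
  obtain ⟨x, hx⟩ := Φ.exists_eq (t := t.toReal) ENNReal.toReal_nonneg
  exact ⟨x, by rw [hx, ENNReal.ofReal_toReal ht]⟩

/-- `Φ` is an order isomorphism of `[0, ∞)`, so every finite `t` is a value of `Φ`. This and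
`inv_le_iff` translate bounds on `Ψ⁻¹(E(Ψ(u)))` into bounds on `E(Ψ(u))`. -/
theorem le_inv_iff (Φ : YoungFunction) {x : ℝ≥0} {t : ℝ≥0∞} :
    (x : ℝ≥0∞) ≤ Φ.inv t ↔ ENNReal.ofReal (Φ x) ≤ t := by
  rcases eq_or_ne t ∞ with rfl | ht
  · simp [Φ.inv_top]
  obtain ⟨y, rfl⟩ := Φ.exists_ofReal_eq ht
  rw [Φ.inv_apply, Φ.ofReal_le_ofReal_iff, ENNReal.coe_le_coe]

theorem inv_le_iff (Φ : YoungFunction) {x : ℝ≥0} {t : ℝ≥0∞} :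
    Φ.inv t ≤ x ↔ t ≤ ENNReal.ofReal (Φ x) := by
  rcases eq_or_ne t ∞ with rfl | ht
  · simp [Φ.inv_top]
  obtain ⟨y, rfl⟩ := Φ.exists_ofReal_eq ht
  rw [Φ.inv_apply, Φ.ofReal_le_ofReal_iff, ENNReal.coe_le_coe]

theorem inv_mono (Φ : YoungFunction) : Monotone Φ.inv := fun s t hst => by
  rcases eq_or_ne t ∞ with rfl | ht
  · simp [Φ.inv_top]
  obtain ⟨y, rfl⟩ := Φ.exists_ofReal_eq ht
  rw [Φ.inv_apply]
  exact Φ.inv_le_iff.2 hst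

theorem measurable_inv (Φ : YoungFunction) : Measurable Φ.inv := Φ.inv_mono.measurable

theorem map_toReal_inv (Φ : YoungFunction) {t : ℝ} (ht : 0 ≤ t) :
    Φ (Φ.inv (ENNReal.ofReal t)).toReal = t := by
  obtain ⟨x, rfl⟩ := Φ.exists_eq ht
  rw [Φ.inv_apply]
  rfl

theorem eval_ne_top (Φ : YoungFunction) (z : ℂ) : Φ.eval z ≠ ∞ := ENNReal.ofReal_ne_top

theorem eval_zero (Φ : YoungFunction) : Φ.eval 0 = 0 := by simp [eval, Φ.map_zero]

theorem measurable_eval (Φ : YoungFunction) : Measurable Φ.eval :=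
  (Φ.continuous'.measurable.comp measurable_norm).ennreal_ofReal

theorem eval_indicator {Ω : Type*} (Φ : YoungFunction) (A : Set Ω) (f : Ω → ℂ) :
    (fun x => Φ.eval (A.indicator f x)) = A.indicator (fun x => Φ.eval (f x)) := by
  ext x
  by_cases hx : x ∈ A <;> simp [hx, Φ.eval_zero]

/-- If `Φ x = Ψ y` with `Ψ` complementary to `Φ`, then this common value is at most `x y`. -/
theorem IsComplementary.le_mul {Φ Ψ : YoungFunction} (h : Φ.IsComplementary Ψ) {x y : ℝ}
    (hx : 0 ≤ x) (hy : 0 ≤ y) (hxy : Φ x = Ψ y) : Ψ y ≤ x * y := by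
  rcases hx.eq_or_lt with rfl | hx
  · rw [← hxy, Φ.map_zero, zero_mul]
  -- The supremum defining `Ψ` at the chord slope `Φ x / x` is over `z * (Φ x / x) - Φ z`. For `z ≤
  -- x` the first term is at most `Φ x`; for `z ≥ x` the difference is nonpositive, since `Φ z / z`
  -- increases.
  have hle : Ψ (Φ x / x) ≤ Φ x := by
    rw [h (Φ x / x), abs_of_nonneg (div_nonneg (Φ.nonneg' x) hx.le)]
    refine csSup_le ⟨_, mem_image_of_mem _ self_mem_Ici⟩ ?_
    rintro _ ⟨z, hz, rfl⟩
    have hz : 0 ≤ z := hz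
    change z * (Φ x / x) - Φ z ≤ Φ x
    rw [mul_div_left_comm]
    rcases le_total z x with hzx | hzx
    · have := mul_le_of_le_one_right (Φ.nonneg' x) ((div_le_one hx).2 hzx)
      linarith [Φ.nonneg' z]
    · have hz0 : 0 < z := hx.trans_le hzx
      have := Φ.map_mul_le (div_nonneg hx.le hz) ((div_le_one hz0).2 hzx) z
      rw [div_mul_cancel₀ x hz0.ne'] at this
      have h2 : Φ x * (z / x) ≤ Φ z := by
        calc Φ x * (z / x) ≤ x / z * Φ z * (z / x) := by gcongr
          _ = Φ z := by field_simp
      linarith [Φ.nonneg' x]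
  by_contra! hlt
  have : y < Φ x / x := by rw [lt_div_iff₀ hx, hxy]; linarith
  exact absurd (Ψ.strictMono hy this) (not_lt.2 (hxy ▸ hle))

/-- Under `Δ'`, `Φ (t q)` dominates `q Φ t`, uniformly in `t` and in `q` bounded away from `0`. -/
theorem DeltaPrime.exists_mul_le {Φ : YoungFunction} (h : Φ.DeltaPrime) {δ : ℝ} (hδ : 0 < δ) :
    ∃ a : ℝ, 0 < a ∧ ∀ t q : ℝ, 0 ≤ t → δ ≤ q → a * q * Φ t ≤ Φ (t * q) := by
  obtain ⟨c, hc, hΦ⟩ := h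
  have hb : 0 < c * Φ δ⁻¹ := mul_pos hc (Φ.pos (inv_pos.2 hδ))
  refine ⟨min 1 (c * Φ δ⁻¹)⁻¹, by positivity, fun t q ht hq => ?_⟩
  have hq0 : 0 < q := hδ.trans_le hq
  have hΦt := Φ.nonneg' t
  -- For `q ≥ 1`, convexity alone gives `q Φ t ≤ Φ (t q)`. For `δ ≤ q ≤ 1`, `Δ'` applied to `t = δ⁻¹
  -- (t δ)` costs the factor `c Φ δ⁻¹`, and `Φ (t δ) ≤ Φ (t q)`.
  rcases le_total 1 q with hq1 | hq1
  · have := Φ.map_mul_le (inv_nonneg.2 hq0.le) (inv_le_one_of_one_le₀ hq1) (t * q)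
    rw [show q⁻¹ * (t * q) = t by field_simp] at this
    calc min 1 (c * Φ δ⁻¹)⁻¹ * q * Φ t ≤ 1 * q * (q⁻¹ * Φ (t * q)) := by
          gcongr
          exact min_le_left _ _
      _ = Φ (t * q) := by field_simp
  · have h1 : Φ t ≤ c * Φ δ⁻¹ * Φ (t * q) := by
      have := hΦ δ⁻¹ (t * δ) (by positivity) (by positivity)
      rw [show δ⁻¹ * (t * δ) = t by field_simp] at this
      refine this.trans ?_
      gcongr
      exact Φ.mono (by positivity) (by gcongr)
    calc min 1 (c * Φ δ⁻¹)⁻¹ * q * Φ t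
        ≤ (c * Φ δ⁻¹)⁻¹ * 1 * (c * Φ δ⁻¹ * Φ (t * q)) := by
          gcongr
          exact min_le_right _ _
      _ = Φ (t * q) := by rw [mul_one, inv_mul_cancel_left₀ hb.ne']

end YoungFunction

/-! ### Atoms of the sub-σ-algebra. -/

section Atoms

variable {Ω : Type*}

theorem consistsOfFinitelyManyAtoms_of_null (𝒜 : MeasurableSpace Ω) [MeasurableSpace Ω]
    {μ : Measure Ω} {N : Set Ω} (h : μ N = 0) : ConsistsOfFinitelyManyAtoms 𝒜 μ N :=
  ⟨0, fun _ => ∅, fun i => i.elim0, fun i => i.elim0, by simpa using ae_eq_empty.2 h⟩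

theorem IsMeasureAtom.consistsOfFinitelyManyAtoms {𝒜 : MeasurableSpace Ω} [MeasurableSpace Ω]
    {μ : Measure Ω} {N : Set Ω} (h : IsMeasureAtom 𝒜 μ N) :
    ConsistsOfFinitelyManyAtoms 𝒜 μ N :=
  ⟨1, fun _ => N, fun _ => h, fun i j hij => absurd (Subsingleton.elim i j) hij, by
    rw [iUnion_const]; exact ae_eq_refl _⟩

theorem IsMeasureAtom.diff_null {𝒜 : MeasurableSpace Ω} [MeasurableSpace Ω]
    {μ : Measure Ω} {N Z : Set Ω} (h : IsMeasureAtom 𝒜 μ N) (hZ : MeasurableSet[𝒜] Z)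
    (hZ0 : μ Z = 0) : IsMeasureAtom 𝒜 μ (N \ Z) := by
  have := measure_sdiff_null (s := N) hZ0
  refine ⟨h.1.diff hZ, by rw [this]; exact h.2.1, fun F hF hFN => ?_⟩
  rw [this]
  exact h.2.2 F hF (hFN.trans sdiff_subset)

/-- Each `A i \ N` is a null set of `𝒜` and can be removed from its atom. Genuine inclusion in `N`
is what keeps two families disjoint from each other in `ConsistsOfFinitelyManyAtoms.union`. -/
theorem ConsistsOfFinitelyManyAtoms.exists_subset {𝒜 : MeasurableSpace Ω} [MeasurableSpace Ω]
    {μ : Measure Ω} {N : Set Ω} (hN : MeasurableSet[𝒜] N)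
    (h : ConsistsOfFinitelyManyAtoms 𝒜 μ N) :
    ∃ (n : ℕ) (A : Fin n → Set Ω), (∀ i, IsMeasureAtom 𝒜 μ (A i)) ∧
      Pairwise (Function.onFun Disjoint A) ∧ (N =ᵐ[μ] ⋃ i, A i) ∧ ∀ i, A i ⊆ N := by
  obtain ⟨n, A, hA, hd, hNA⟩ := h
  have hnull : ∀ i, μ (A i \ N) = 0 := fun i =>
    measure_mono_null (sdiff_subset_sdiff_left (subset_iUnion A i)) (ae_le_set.1 hNA.symm.le)
  refine ⟨n, fun i => A i \ (A i \ N), fun i => (hA i).diff_null ((hA i).1.diff hN) (hnull i),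
    fun i j hij => (hd hij).mono sdiff_subset sdiff_subset, hNA.trans ?_, fun i x hx => ?_⟩
  · have : ∀ i, A i =ᵐ[μ] (A i \ (A i \ N) : Set Ω) := fun i =>
      (sdiff_null_ae_eq_self (hnull i)).symm
    exact Filter.EventuallyEq.countable_iUnion this
  · by_contra hxN
    exact hx.2 ⟨hx.1, hxN⟩

theorem ConsistsOfFinitelyManyAtoms.union {𝒜 : MeasurableSpace Ω} [MeasurableSpace Ω]
    {μ : Measure Ω} {N M : Set Ω} (hN : MeasurableSet[𝒜] N)
    (hM : MeasurableSet[𝒜] M) (hNM : Disjoint N M)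
    (h : ConsistsOfFinitelyManyAtoms 𝒜 μ N) (h' : ConsistsOfFinitelyManyAtoms 𝒜 μ M) :
    ConsistsOfFinitelyManyAtoms 𝒜 μ (N ∪ M) := by
  obtain ⟨n, A, hA, hAd, hNA, hAN⟩ := h.exists_subset hN
  obtain ⟨m, B, hB, hBd, hMB, hBM⟩ := h'.exists_subset hM
  let D : Fin n ⊕ Fin m → Set Ω := Sum.elim A B
  have hD : Pairwise (Function.onFun Disjoint D) := by
    rintro (i | i) (j | j) hij
    · exact hAd (fun h => hij (by rw [h]))
    · exact hNM.mono (hAN i) (hBM j)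
    · exact hNM.symm.mono (hBM i) (hAN j)
    · exact hBd (fun h => hij (by rw [h]))
  refine ⟨n + m, D ∘ finSumFinEquiv.symm, fun i => ?_, fun i j hij => ?_, ?_⟩
  · change IsMeasureAtom 𝒜 μ (D (finSumFinEquiv.symm i))
    rcases finSumFinEquiv.symm i with j | j
    exacts [hA j, hB j]
  · exact hD (finSumFinEquiv.symm.injective.ne hij)
  · have : (⋃ i, (D ∘ finSumFinEquiv.symm) i) = (⋃ i, A i) ∪ ⋃ i, B i := by
      rw [← iUnion_sumElim]
      exact finSumFinEquiv.symm.surjective.iUnion_comp D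
    rw [this]
    exact hNA.union hMB

/-- A set which does not consist of finitely many atoms contains a disjoint sequence of sets of
positive finite measure. -/
theorem exists_disjoint_seq_of_not_consistsOfFinitelyManyAtoms {𝒜 : MeasurableSpace Ω}
    [mΩ : MeasurableSpace Ω] (h𝒜 : 𝒜 ≤ mΩ) {μ : Measure Ω} [SigmaFinite (μ.trim h𝒜)] {N : Set Ω}
    (hN : MeasurableSet[𝒜] N) (h : ¬ ConsistsOfFinitelyManyAtoms 𝒜 μ N) :
    ∃ A : ℕ → Set Ω, (∀ n, MeasurableSet[𝒜] (A n) ∧ A n ⊆ N ∧ 0 < μ (A n) ∧ μ (A n) < ∞) ∧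
      Pairwise (Function.onFun Disjoint A) := by
  -- Such a `B` is not null and not an atom, so it splits into two `𝒜`-sets of positive measure. At
  -- least one of them again fails to consist of finitely many atoms; keep it and discard the other.
  have step : ∀ B : {B : Set Ω // MeasurableSet[𝒜] B ∧ ¬ ConsistsOfFinitelyManyAtoms 𝒜 μ B},
      ∃ B' : {B : Set Ω // MeasurableSet[𝒜] B ∧ ¬ ConsistsOfFinitelyManyAtoms 𝒜 μ B},
        B'.1 ⊆ B.1 ∧ 0 < μ (B.1 \ B'.1) := by
    rintro ⟨B, hB, hBn⟩
    have hB0 : 0 < μ B := pos_iff_ne_zero.2 fun h0 =>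
      hBn (consistsOfFinitelyManyAtoms_of_null 𝒜 h0)
    have hBa : ¬ IsMeasureAtom 𝒜 μ B := fun ha => hBn ha.consistsOfFinitelyManyAtoms
    simp only [IsMeasureAtom, hB, hB0, true_and, not_forall, not_or] at hBa
    obtain ⟨F, hF, hFB, hF0, hFB'⟩ := hBa
    have hdiff : 0 < μ (B \ F) := pos_iff_ne_zero.2 fun h0 => hFB' <|
      le_antisymm (measure_mono hFB) (by
        calc μ B ≤ μ (F ∪ B \ F) := measure_mono (by rw [union_sdiff_cancel hFB])
          _ ≤ μ F + μ (B \ F) := measure_union_le _ _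
          _ = μ F := by rw [h0, add_zero])
    by_cases hFn : ConsistsOfFinitelyManyAtoms 𝒜 μ F
    · refine ⟨⟨B \ F, hB.diff hF, fun h' => hBn ?_⟩, sdiff_subset, ?_⟩
      · rw [← union_sdiff_cancel hFB]
        exact hFn.union hF (hB.diff hF) disjoint_sdiff_right h'
      · simpa [sdiff_sdiff_cancel_left hFB] using pos_iff_ne_zero.2 hF0
    · exact ⟨⟨F, hF, hFn⟩, hFB, hdiff⟩
  choose next hnext hpos using step
  let B : ℕ → {B : Set Ω // MeasurableSet[𝒜] B ∧ ¬ ConsistsOfFinitelyManyAtoms 𝒜 μ B} :=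
    fun n => next^[n] ⟨N, hN, h⟩
  have hB : ∀ n, B (n + 1) = next (B n) := fun n => Function.iterate_succ_apply' _ _ _
  have hanti : Antitone (fun n => (B n).1) := antitone_nat_of_succ_le fun n => by
    simp only [hB]
    exact hnext _
  -- The discarded pieces are disjoint but may have infinite measure; σ-finiteness on `𝒜` supplies a
  -- subset of positive finite measure in each.
  have hfin : ∀ n, ∃ k, 0 < μ (((B n).1 \ (B (n + 1)).1) ∩ spanningSets (μ.trim h𝒜) k) := by
    intro n
    by_contra! hk
    have : μ (⋃ k, ((B n).1 \ (B (n + 1)).1) ∩ spanningSets (μ.trim h𝒜) k) = 0 :=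
      measure_iUnion_null fun k => le_antisymm (hk k) zero_le
    rw [← inter_iUnion, iUnion_spanningSets, inter_univ, hB] at this
    exact (hpos (B n)).ne' this
  choose k hk using hfin
  refine ⟨fun n => ((B n).1 \ (B (n + 1)).1) ∩ spanningSets (μ.trim h𝒜) (k n), fun n =>
    ⟨((B n).2.1.diff (B (n + 1)).2.1).inter (measurableSet_spanningSets _ _), ?_, hk n, ?_⟩, ?_⟩
  · exact (inter_subset_left.trans sdiff_subset).trans (hanti (Nat.zero_le n))
  · refine (measure_mono inter_subset_right).trans_lt ?_
    rw [← trim_measurableSet_eq h𝒜 (measurableSet_spanningSets _ _)]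
    exact measure_spanningSets_lt_top _ _
  · refine (pairwise_disjoint_on _).2 fun m n hmn => ?_
    refine disjoint_left.2 fun x hx hx' => hx.1.2 ?_
    exact hanti (Nat.succ_le_of_lt hmn) hx'.1.1

/-- The spanning sets cut an atom into pieces of finite measure. Were the atom of infinite measure,
each piece would have to be null, and so would the atom. -/
theorem IsMeasureAtom.measure_lt_top {𝒜 : MeasurableSpace Ω} [mΩ : MeasurableSpace Ω]
    (h𝒜 : 𝒜 ≤ mΩ) {μ : Measure Ω} [SigmaFinite (μ.trim h𝒜)] {A : Set Ω}
    (hA : IsMeasureAtom 𝒜 μ A) : μ A < ∞ := by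
  by_contra htop
  have hnull : ∀ k, μ (A ∩ spanningSets (μ.trim h𝒜) k) = 0 := fun k => by
    refine (hA.2.2 _ (hA.1.inter (measurableSet_spanningSets _ _)) inter_subset_left).resolve_right
      fun h => htop ?_
    rw [← h]
    refine (measure_mono inter_subset_right).trans_lt ?_
    rw [← trim_measurableSet_eq h𝒜 (measurableSet_spanningSets _ _)]
    exact measure_spanningSets_lt_top _ _
  have := measure_iUnion_null hnull
  rw [← inter_iUnion, iUnion_spanningSets, inter_univ] at this
  exact hA.2.1.ne' this

/-- Measurable functions are a.e. constant on atoms. -/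
theorem IsMeasureAtom.exists_ae_eq_const {𝒜 : MeasurableSpace Ω} [mΩ : MeasurableSpace Ω]
    (h𝒜 : 𝒜 ≤ mΩ) {μ : Measure Ω} [SigmaFinite (μ.trim h𝒜)] {A : Set Ω}
    (hA : IsMeasureAtom 𝒜 μ A) {f : Ω → ℂ} (hf : Measurable[𝒜] f) :
    ∃ c : ℂ, ∀ᵐ x ∂μ, x ∈ A → f x = c := by
  have key : ∃ c, f =ᶠ[ae (μ.restrict A)] Function.const Ω c := by
    -- A zero-one law: each preimage is null or conull in the atom. Since countably many measurable
    -- sets separate the points of `ℂ`, the function is a.e. constant.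
    refine Filter.exists_eventuallyEq_const_of_forall_separating MeasurableSet fun U hU => ?_
    have hm : MeasurableSet[𝒜] (A ∩ f ⁻¹' U) := hA.1.inter (hf hU)
    rw [ae_restrict_iff' (h𝒜 _ hA.1), ae_restrict_iff' (h𝒜 _ hA.1)]
    rcases hA.2.2 _ hm inter_subset_left with h0 | h1
    · right
      filter_upwards [measure_eq_zero_iff_ae_notMem.1 h0] with x hx hxA hxU using hx ⟨hxA, hxU⟩
    · left
      have h0 : μ (A \ (A ∩ f ⁻¹' U)) = 0 := by
        rw [measure_sdiff inter_subset_left (h𝒜 _ hm).nullMeasurableSet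
          (h1 ▸ (hA.measure_lt_top h𝒜).ne), h1, tsub_self]
      filter_upwards [measure_eq_zero_iff_ae_notMem.1 h0] with x hx hxA
      by_contra hxU
      exact hx ⟨hxA, fun h => hxU h.2⟩
  obtain ⟨c, hc⟩ := key
  exact ⟨c, (ae_restrict_iff' (h𝒜 _ hA.1)).1 hc⟩

end Atoms

/-! ### Locality and bounds for conditional expectations. -/

section CondExpLemmas

variable {Ω : Type*}

theorem condLExp_indicator {𝒜 : MeasurableSpace Ω} [mΩ : MeasurableSpace Ω] (h𝒜 : 𝒜 ≤ mΩ)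
    (μ : Measure Ω) [SigmaFinite (μ.trim h𝒜)] (X : Ω → ℝ≥0∞) {A : Set Ω}
    (hA : MeasurableSet[𝒜] A) :
    condLExp 𝒜 μ (A.indicator X) =ᵐ[μ] A.indicator (condLExp 𝒜 μ X) := by
  refine (ae_eq_condLExp h𝒜 μ _ ((measurable_condLExp 𝒜 μ X).indicator hA) fun s hs => ?_).symm
  rw [setLIntegral_indicator (h𝒜 _ hA), setLIntegral_indicator (h𝒜 _ hA),
    setLIntegral_condLExp h𝒜 μ X (hA.inter hs)]

/-- Multiply both functions by `1_A`: they become a.e. equal, and `1_A` passes through the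
conditional expectation. -/
theorem condLExp_eq_on {𝒜 : MeasurableSpace Ω} [mΩ : MeasurableSpace Ω] (h𝒜 : 𝒜 ≤ mΩ)
    (μ : Measure Ω) [SigmaFinite (μ.trim h𝒜)] {X Y : Ω → ℝ≥0∞} {A : Set Ω}
    (hA : MeasurableSet[𝒜] A) (h : ∀ᵐ x ∂μ, x ∈ A → X x = Y x) :
    ∀ᵐ x ∂μ, x ∈ A → condLExp 𝒜 μ X x = condLExp 𝒜 μ Y x := by
  have hXY : A.indicator X =ᵐ[μ] A.indicator Y := by
    filter_upwards [h] with x hx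
    by_cases hxA : x ∈ A <;> simp [hxA, hx]
  filter_upwards [condLExp_indicator h𝒜 μ X hA, condLExp_indicator h𝒜 μ Y hA,
    condLExp_congr_ae (mΩ := 𝒜) hXY] with x h1 h2 h3 hxA
  rw [h1, h2, indicator_of_mem hxA, indicator_of_mem hxA] at h3
  exact h3

theorem condE_eq_on {𝒜 : MeasurableSpace Ω} [mΩ : MeasurableSpace Ω] (h𝒜 : 𝒜 ≤ mΩ)
    (μ : Measure Ω) [SigmaFinite (μ.trim h𝒜)] {f g : Ω → ℂ} {A : Set Ω}
    (hA : MeasurableSet[𝒜] A) (h : ∀ᵐ x ∂μ, x ∈ A → f x = g x) :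
    ∀ᵐ x ∂μ, x ∈ A → condE 𝒜 μ f x = condE 𝒜 μ g x := by
  have key : ∀ F : ℂ → ℝ≥0∞, ∀ᵐ x ∂μ, x ∈ A →
      condLExp 𝒜 μ (fun x => F (f x)) x = condLExp 𝒜 μ (fun x => F (g x)) x := fun F =>
    condLExp_eq_on h𝒜 μ hA (h.mono fun x hx hxA => by rw [hx hxA])
  filter_upwards [key fun z => ENNReal.ofReal z.re, key fun z => ENNReal.ofReal (-z.re),
    key fun z => ENNReal.ofReal z.im, key fun z => ENNReal.ofReal (-z.im)] with x h1 h2 h3 h4 hxA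
  simp only [condE, h1 hxA, h2 hxA, h3 hxA, h4 hxA]

theorem condE_zero {𝒜 : MeasurableSpace Ω} [mΩ : MeasurableSpace Ω] (μ : Measure Ω) (x : Ω) :
    condE 𝒜 μ (fun _ => 0) x = 0 := by
  have : (fun _ : Ω => (0 : ℝ≥0∞)) = 0 := rfl
  simp [condE, this, Complex.ext_iff]

theorem measurable_condE (𝒜 : MeasurableSpace Ω) [mΩ : MeasurableSpace Ω] (μ : Measure Ω)
    (f : Ω → ℂ) : Measurable[𝒜] (condE 𝒜 μ f) := by
  have key : ∀ X : Ω → ℝ≥0∞, Measurable[𝒜] fun x => (condLExp 𝒜 μ X x).toReal := fun X =>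
    ENNReal.measurable_toReal.comp (measurable_condLExp 𝒜 μ X)
  have h1 := (key fun x => ENNReal.ofReal (f x).re).sub (key fun x => ENNReal.ofReal (-(f x).re))
  have h2 := (key fun x => ENNReal.ofReal (f x).im).sub (key fun x => ENNReal.ofReal (-(f x).im))
  exact Complex.measurableEquivRealProd.symm.measurable.comp (h1.prodMk h2)

/-- The real and imaginary parts are each a difference of two numbers in `[0, E(|f|)]`, whence the
factor `2`. The sharp constant `1` is not needed. -/
theorem enorm_condE_le {𝒜 : MeasurableSpace Ω} [mΩ : MeasurableSpace Ω] (μ : Measure Ω)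
    (f : Ω → ℂ) : ∀ᵐ x ∂μ, ‖condE 𝒜 μ f x‖ₑ ≤ 2 * condLExp 𝒜 μ (fun x => ‖f x‖ₑ) x := by
  have key : ∀ F : ℂ → ℝ, (∀ z, F z ≤ ‖z‖) → ∀ᵐ x ∂μ,
      condLExp 𝒜 μ (fun x => ENNReal.ofReal (F (f x))) x ≤ condLExp 𝒜 μ (fun x => ‖f x‖ₑ) x :=
    fun F hF => condLExp_mono (Eventually.of_forall fun x => by
      beta_reduce
      rw [← ofReal_norm]
      exact ENNReal.ofReal_le_ofReal (hF _))
  filter_upwards [key (fun z => z.re) Complex.re_le_norm,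
    key (fun z => -z.re) (fun z => (neg_le_abs _).trans (Complex.abs_re_le_norm z)),
    key (fun z => z.im) Complex.im_le_norm,
    key (fun z => -z.im) (fun z => (neg_le_abs _).trans (Complex.abs_im_le_norm z))]
    with x h1 h2 h3 h4
  rcases eq_or_ne (condLExp 𝒜 μ (fun x => ‖f x‖ₑ) x) ∞ with htop | htop
  · simp [htop]
  have hsub : ∀ {a b c : ℝ≥0∞}, c ≠ ∞ → a ≤ c → b ≤ c → |a.toReal - b.toReal| ≤ c.toReal := by
    intro a b c hc ha hb
    have h1 := ENNReal.toReal_mono hc ha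
    have h2 := ENNReal.toReal_mono hc hb
    rw [abs_le]
    constructor <;> linarith [@ENNReal.toReal_nonneg a, @ENNReal.toReal_nonneg b]
  rw [← ofReal_norm]
  refine ENNReal.ofReal_le_of_le_toReal ?_
  rw [ENNReal.toReal_mul, ENNReal.toReal_ofNat, two_mul]
  exact (Complex.norm_le_abs_re_add_abs_im _).trans
    (add_le_add (hsub htop h1 h2) (hsub htop h3 h4))

theorem condE_ofReal {𝒜 : MeasurableSpace Ω} [mΩ : MeasurableSpace Ω] (μ : Measure Ω)
    {g : Ω → ℝ} (hg : ∀ x, 0 ≤ g x) (x : Ω) :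
    condE 𝒜 μ (fun x => (g x : ℂ)) x =
      ((condLExp 𝒜 μ (fun x => ENNReal.ofReal (g x)) x).toReal : ℂ) := by
  have h0 : (fun x : Ω => ENNReal.ofReal (-(g x))) = 0 := by
    ext x
    simp [hg x]
  have h1 : (fun _ : Ω => (0 : ℝ≥0∞)) = 0 := rfl
  simp [condE, h0, h1, Complex.ext_iff]

end CondExpLemmas

/-! ### Orlicz spaces: monotonicity, restriction to sets, completeness. -/

section OrliczLemmas

variable {Ω : Type*} [MeasurableSpace Ω] {μ : Measure Ω} {Φ : YoungFunction}

namespace OrliczSpace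

/-- The element of the Orlicz space defined by a function in the Orlicz class. -/
noncomputable def mk (f : Ω → ℂ) (hf : MemOrlicz Φ μ f) : OrliczSpace Φ μ :=
  ⟨AEEqFun.mk f hf.1, hf.congr (AEEqFun.coeFn_mk f hf.1).symm⟩

theorem coe_mk {f : Ω → ℂ} (hf : MemOrlicz Φ μ f) :
    ((mk f hf : OrliczSpace Φ μ) : Ω →ₘ[μ] ℂ) =ᵐ[μ] f := AEEqFun.coeFn_mk f hf.1

theorem memOrlicz (f : OrliczSpace Φ μ) : MemOrlicz Φ μ (f : Ω →ₘ[μ] ℂ) := f.2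

theorem ext_ae {f g : OrliczSpace Φ μ}
    (h : ((f : Ω →ₘ[μ] ℂ) : Ω → ℂ) =ᵐ[μ] (g : Ω →ₘ[μ] ℂ)) : f = g :=
  Subtype.ext (AEEqFun.ext h)

theorem coe_add (f g : OrliczSpace Φ μ) :
    (((f + g : OrliczSpace Φ μ) : Ω →ₘ[μ] ℂ) : Ω → ℂ) =ᵐ[μ]
      fun x => (f : Ω →ₘ[μ] ℂ) x + (g : Ω →ₘ[μ] ℂ) x := AEEqFun.coeFn_add _ _

theorem coe_sub (f g : OrliczSpace Φ μ) :
    (((f - g : OrliczSpace Φ μ) : Ω →ₘ[μ] ℂ) : Ω → ℂ) =ᵐ[μ]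
      fun x => (f : Ω →ₘ[μ] ℂ) x - (g : Ω →ₘ[μ] ℂ) x := AEEqFun.coeFn_sub _ _

theorem coe_smul (c : ℂ) (f : OrliczSpace Φ μ) :
    (((c • f : OrliczSpace Φ μ) : Ω →ₘ[μ] ℂ) : Ω → ℂ) =ᵐ[μ]
      fun x => c * (f : Ω →ₘ[μ] ℂ) x := AEEqFun.coeFn_smul _ _

theorem norm_le_of_mem {f : OrliczSpace Φ μ} {k : ℝ}
    (hk : k ∈ luxemburgSet Φ μ (f : Ω →ₘ[μ] ℂ)) : ‖f‖ ≤ k :=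
  csInf_le (luxemburgSet_bddBelow _ _ _) hk

theorem mem_of_norm_lt {f : OrliczSpace Φ μ} {k : ℝ} (hk : ‖f‖ < k) :
    k ∈ luxemburgSet Φ μ (f : Ω →ₘ[μ] ℂ) := by
  obtain ⟨l, hl, hlk⟩ := exists_lt_of_csInf_lt (luxemburgSet_nonempty f.2) hk
  exact luxemburgSet_up Φ hl hlk.le

/-- Small norm implies small modular. -/
theorem lintegral_eval_le {f : OrliczSpace Φ μ} {k : ℝ} (hk1 : k ≤ 1) (hk : ‖f‖ < k) :
    ∫⁻ x, Φ.eval ((f : Ω →ₘ[μ] ℂ) x) ∂μ ≤ ENNReal.ofReal k := by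
  have hmem := mem_of_norm_lt hk
  have hk0 : 0 < k := hmem.1
  calc ∫⁻ x, Φ.eval ((f : Ω →ₘ[μ] ℂ) x) ∂μ
      ≤ ∫⁻ x, ENNReal.ofReal k * Φ.eval ((f : Ω →ₘ[μ] ℂ) x / k) ∂μ := by
        refine lintegral_mono fun x => ?_
        have h1 := Φ.eval_smul_le hk0.le hk1 ((f : Ω →ₘ[μ] ℂ) x / k)
        have hk' : (k : ℂ) ≠ 0 := by exact_mod_cast hk0.ne'
        rwa [mul_div_cancel₀ _ hk'] at h1
    _ = ENNReal.ofReal k * ∫⁻ x, Φ.eval ((f : Ω →ₘ[μ] ℂ) x / k) ∂μ :=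
        lintegral_const_mul' _ _ ENNReal.ofReal_ne_top
    _ ≤ ENNReal.ofReal k * 1 := by
        gcongr
        exact hmem.2
    _ = ENNReal.ofReal k := mul_one _

end OrliczSpace

theorem luxemburgSet_mono {f g : Ω → ℂ} (h : ∀ᵐ x ∂μ, ‖f x‖ ≤ ‖g x‖) :
    luxemburgSet Φ μ g ⊆ luxemburgSet Φ μ f := fun k hk =>
  ⟨hk.1, (lintegral_mono_ae (h.mono fun x hx => Φ.eval_mono (by
    rw [norm_div, norm_div]; gcongr))).trans hk.2⟩

theorem MemOrlicz.mono {f g : Ω → ℂ} (hg : MemOrlicz Φ μ g) (hf : AEStronglyMeasurable f μ)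
    (h : ∀ᵐ x ∂μ, ‖f x‖ ≤ ‖g x‖) : MemOrlicz Φ μ f := by
  obtain ⟨k, hk⟩ := luxemburgSet_nonempty hg
  exact memOrlicz_of_mem hf (luxemburgSet_mono h hk)

theorem luxemburgNorm_mono {f g : Ω → ℂ} (hg : MemOrlicz Φ μ g)
    (h : ∀ᵐ x ∂μ, ‖f x‖ ≤ ‖g x‖) : luxemburgNorm Φ μ f ≤ luxemburgNorm Φ μ g :=
  csInf_le_csInf (luxemburgSet_bddBelow _ _ _) (luxemburgSet_nonempty hg) (luxemburgSet_mono h)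

theorem OrliczSpace.norm_mono {f g : OrliczSpace Φ μ}
    (h : ∀ᵐ x ∂μ, ‖(f : Ω →ₘ[μ] ℂ) x‖ ≤ ‖(g : Ω →ₘ[μ] ℂ) x‖) : ‖f‖ ≤ ‖g‖ :=
  luxemburgNorm_mono g.2 h

theorem MemOrlicz.indicator {f : Ω → ℂ} (hf : MemOrlicz Φ μ f) {A : Set Ω}
    (hA : MeasurableSet A) : MemOrlicz Φ μ (A.indicator f) :=
  hf.mono (hf.1.indicator hA) (Eventually.of_forall fun _ => norm_indicator_le_norm_self _ _)

theorem memOrlicz_indicator_one (Φ : YoungFunction) {A : Set Ω} (hA : MeasurableSet A)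
    (hfin : μ A < ∞) : MemOrlicz Φ μ (A.indicator 1) := by
  refine ⟨(stronglyMeasurable_one.indicator hA).aestronglyMeasurable, 1, one_pos, ?_⟩
  have : (fun x => Φ.eval (((1 : ℝ) : ℂ) * A.indicator 1 x)) =
      A.indicator fun _ => Φ.eval 1 := by
    ext x
    by_cases hx : x ∈ A <;> simp [hx, Φ.eval_zero]
  rw [this, lintegral_indicator hA, setLIntegral_const]
  exact ENNReal.mul_lt_top (Φ.eval_ne_top 1).lt_top hfin

namespace OrliczSpace

/-- Multiplication by the indicator function of a measurable set. -/
noncomputable def indicatorCLM (Φ : YoungFunction) (μ : Measure Ω) {A : Set Ω}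
    (hA : MeasurableSet A) : OrliczSpace Φ μ →L[ℂ] OrliczSpace Φ μ :=
  LinearMap.mkContinuous
    { toFun := fun f => mk (A.indicator (f : Ω →ₘ[μ] ℂ)) ((memOrlicz f).indicator hA)
      map_add' := fun f g => ext_ae <| by
        filter_upwards [coe_mk ((memOrlicz (f + g)).indicator hA),
          coe_mk ((memOrlicz f).indicator hA),
          coe_mk ((memOrlicz g).indicator hA), coe_add f g,
          coe_add (mk _ ((memOrlicz f).indicator hA)) (mk _ ((memOrlicz g).indicator hA))]
          with x h1 h2 h3 h4 h5
        rw [h1, h5, h2, h3]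
        by_cases hx : x ∈ A <;> simp only [hx, h4, indicator_of_mem, not_false_eq_true,
          indicator_of_notMem, add_zero]
      map_smul' := fun c f => ext_ae <| by
        filter_upwards [coe_mk ((memOrlicz (c • f)).indicator hA),
          coe_mk ((memOrlicz f).indicator hA),
          coe_smul c f, coe_smul c (mk _ ((memOrlicz f).indicator hA))] with x h1 h2 h3 h4
        rw [h1, RingHom.id_apply, h4, h2]
        by_cases hx : x ∈ A <;> simp only [hx, h3, indicator_of_mem, not_false_eq_true,
          indicator_of_notMem, mul_zero] }
    1 fun f => by
      rw [one_mul]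
      refine norm_mono ?_
      filter_upwards [coe_mk ((memOrlicz f).indicator hA)] with x hx
      change ‖((mk _ ((memOrlicz f).indicator hA) : OrliczSpace Φ μ) : Ω →ₘ[μ] ℂ) x‖ ≤ _
      rw [hx]
      exact norm_indicator_le_norm_self _ _

theorem coe_indicatorCLM {A : Set Ω} (hA : MeasurableSet A) (f : OrliczSpace Φ μ) :
    ((indicatorCLM Φ μ hA f : Ω →ₘ[μ] ℂ) : Ω → ℂ) =ᵐ[μ] A.indicator (f : Ω →ₘ[μ] ℂ) :=
  coe_mk ((memOrlicz f).indicator hA)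

theorem coe_sum {ι : Type*} (s : Finset ι) (f : ι → OrliczSpace Φ μ) :
    (((∑ i ∈ s, f i : OrliczSpace Φ μ) : Ω →ₘ[μ] ℂ) : Ω → ℂ) =ᵐ[μ]
      fun x => ∑ i ∈ s, (f i : Ω →ₘ[μ] ℂ) x := by
  classical
  induction s using Finset.induction_on with
  | empty =>
    simp only [Finset.sum_empty]
    exact AEEqFun.coeFn_zero
  | insert a s ha ih =>
    rw [Finset.sum_insert ha]
    filter_upwards [coe_add (f a) (∑ i ∈ s, f i), ih] with x h1 h2
    rw [h1, h2, Finset.sum_insert ha]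

/-- If a sequence is bounded by `k` in the Luxemburg norm and converges a.e., then the limit is
bounded by `k`. -/
theorem mem_luxemburgSet_of_tendsto {f : ℕ → Ω → ℂ} {g : Ω → ℂ} {k : ℝ}
    (hf : ∀ n, AEStronglyMeasurable (f n) μ)
    (hk : ∀ᶠ n in atTop, k ∈ luxemburgSet Φ μ (f n))
    (h : ∀ᵐ x ∂μ, Tendsto (fun n => f n x) atTop (𝓝 (g x))) : k ∈ luxemburgSet Φ μ g := by
  refine ⟨hk.exists.choose_spec.1, ?_⟩
  have hcont : Continuous fun z : ℂ => Φ.eval (z / k) :=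
    ENNReal.continuous_ofReal.comp (Φ.continuous'.comp (continuous_id.div_const _).norm)
  calc ∫⁻ x, Φ.eval (g x / k) ∂μ
      ≤ ∫⁻ x, liminf (fun n => Φ.eval (f n x / k)) atTop ∂μ := by
        refine lintegral_mono_ae (h.mono fun x hx => ?_)
        exact ((hcont.tendsto _).comp hx).liminf_eq.ge
    _ ≤ liminf (fun n => ∫⁻ x, Φ.eval (f n x / k) ∂μ) atTop :=
        lintegral_liminf_le' fun n => Φ.aemeasurable_eval (by
          simpa only [div_eq_mul_inv] using (hf n).mul_const _)
    _ ≤ 1 := by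
        refine liminf_le_of_frequently_le' (hk.mono fun n hn => hn.2).frequently

/-- Passing to `|f|` lets the triangle inequality in `L^Φ` control partial sums of absolute values
in the completeness proof. -/
theorem norm_abs_mk (f : OrliczSpace Φ μ) :
    ∃ g : OrliczSpace Φ μ, ‖g‖ = ‖f‖ ∧ ((g : Ω →ₘ[μ] ℂ) : Ω → ℂ) =ᵐ[μ]
      fun x => ((‖(f : Ω →ₘ[μ] ℂ) x‖ : ℝ) : ℂ) := by
  have hm : MemOrlicz Φ μ fun x => ((‖(f : Ω →ₘ[μ] ℂ) x‖ : ℝ) : ℂ) :=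
    (memOrlicz f).mono (Complex.continuous_ofReal.comp_aestronglyMeasurable (memOrlicz f).1.norm)
      (Eventually.of_forall fun x => by simp)
  refine ⟨mk _ hm, le_antisymm (norm_mono ?_) (norm_mono ?_), coe_mk hm⟩ <;>
  · filter_upwards [coe_mk hm] with x hx
    simp [hx]

/-- The Orlicz space is a Banach space. -/
instance completeSpace (Φ : YoungFunction) (μ : Measure Ω) : CompleteSpace (OrliczSpace Φ μ) := by
  refine NormedAddCommGroup.completeSpace_of_summable_imp_tendsto fun f hf => ?_
  set S : ℝ := ∑' n, ‖f n‖ with hS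
  have hS0 : 0 ≤ S := tsum_nonneg fun _ => norm_nonneg _
  choose g hg hgf using fun n => norm_abs_mk (f n)
  -- The slack in `S + 1` gives a positive number strictly above all the norms, even when `S = 0`.
  have hbound : ∀ n, S + 1 ∈ luxemburgSet Φ μ
      (fun x => ∑ i ∈ Finset.range n, (g i : Ω →ₘ[μ] ℂ) x) := by
    intro n
    rw [← luxemburgSet_congr Φ (coe_sum (Finset.range n) g)]
    refine mem_of_norm_lt (lt_of_le_of_lt (norm_sum_le _ _) ?_)
    simp only [hg]
    have := hf.sum_le_tsum (Finset.range n) fun _ _ => norm_nonneg _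
    linarith
  have hmono : ∀ᵐ x ∂μ, ∀ n, (g n : Ω →ₘ[μ] ℂ) x = ((‖(f n : Ω →ₘ[μ] ℂ) x‖ : ℝ) : ℂ) :=
    ae_all_iff.2 hgf
  -- By monotone convergence the supremum of the modular densities of the partial sums is
  -- integrable, hence a.e. finite. Inverting `Φ` bounds the partial sums themselves.
  have hsummable : ∀ᵐ x ∂μ, Summable fun n => ‖(f n : Ω →ₘ[μ] ℂ) x‖ := by
    have hint : ∫⁻ x, ⨆ n, Φ.eval ((∑ i ∈ Finset.range n, (g i : Ω →ₘ[μ] ℂ) x) / (S + 1 : ℝ)) ∂μ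
        ≤ 1 := by
      rw [lintegral_iSup']
      · exact iSup_le fun n => (hbound n).2
      · intro n
        refine Φ.aemeasurable_eval ?_
        simp only [div_eq_mul_inv]
        exact (Finset.aestronglyMeasurable_fun_sum _ fun i _ => (memOrlicz (g i)).1).mul_const _
      · filter_upwards [hmono] with x hx
        refine monotone_nat_of_le_succ fun n => Φ.eval_mono ?_
        simp only [norm_div, hx, ← Complex.ofReal_sum, Complex.norm_real]
        gcongr
        rw [Real.norm_of_nonneg (by positivity), Real.norm_of_nonneg (by positivity),
          Finset.sum_range_succ]
        exact le_add_of_nonneg_right (norm_nonneg _)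
    have hfin := ae_lt_top' (.iSup fun n => Φ.aemeasurable_eval (by
      simp only [div_eq_mul_inv]
      exact (Finset.aestronglyMeasurable_fun_sum _ fun i _ => (memOrlicz (g i)).1).mul_const _))
      (hint.trans_lt ENNReal.one_lt_top).ne
    filter_upwards [hfin, hmono] with x hx hxg
    obtain ⟨y, hy⟩ := Φ.exists_ofReal_eq hx.ne
    refine summable_of_sum_range_le (c := y * (S + 1)) (fun _ => norm_nonneg _) fun n => ?_
    have h1 : Φ.eval ((∑ i ∈ Finset.range n, (g i : Ω →ₘ[μ] ℂ) x) / (S + 1 : ℝ)) ≤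
        ENNReal.ofReal (Φ y) := by
      rw [hy]
      exact le_iSup (fun n => Φ.eval ((∑ i ∈ Finset.range n, (g i : Ω →ₘ[μ] ℂ) x) /
        (S + 1 : ℝ))) n
    rw [YoungFunction.eval, ENNReal.ofReal_le_ofReal_iff (Φ.nonneg' _),
      Φ.map_le_map_iff (norm_nonneg _) y.coe_nonneg] at h1
    simp only [norm_div, hxg, ← Complex.ofReal_sum, Complex.norm_real] at h1
    rw [Real.norm_of_nonneg (by positivity), Real.norm_of_nonneg (by positivity),
      div_le_iff₀ (by positivity)] at h1
    exact h1
  let s : ℕ → OrliczSpace Φ μ := fun n => ∑ i ∈ Finset.range n, f i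
  let h : Ω → ℂ := fun x => ∑' n, (f n : Ω →ₘ[μ] ℂ) x
  have hs : ∀ᵐ x ∂μ, ∀ n, (s n : Ω →ₘ[μ] ℂ) x = ∑ i ∈ Finset.range n, (f i : Ω →ₘ[μ] ℂ) x :=
    ae_all_iff.2 fun n => coe_sum (Finset.range n) f
  have hlim : ∀ᵐ x ∂μ, Tendsto (fun n => (s n : Ω →ₘ[μ] ℂ) x) atTop (𝓝 (h x)) := by
    filter_upwards [hs, hsummable] with x hx hxs
    simp only [hx]
    exact hxs.of_norm.hasSum.tendsto_sum_nat
  have hcauchy : CauchySeq s := (cauchySeq_finset_of_summable_norm hf).comp_tendsto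
    tendsto_finset_range
  have hmeas : AEStronglyMeasurable h μ :=
    aestronglyMeasurable_of_tendsto_ae atTop (fun n => (memOrlicz (s n)).1) hlim
  -- Fatou's lemma transfers the Cauchy estimate for `s m - s n` to the a.e. limit in `m`.
  have hdist : ∀ ε : ℝ, 0 < ε → ∃ N, ∀ n ≥ N,
      ε ∈ luxemburgSet Φ μ (fun x => h x - (s n : Ω →ₘ[μ] ℂ) x) := by
    intro ε hε
    obtain ⟨N, hN⟩ := Metric.cauchySeq_iff.1 hcauchy ε hε
    refine ⟨N, fun n hn => mem_luxemburgSet_of_tendsto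
      (f := fun m x => (s m : Ω →ₘ[μ] ℂ) x - (s n : Ω →ₘ[μ] ℂ) x)
      (fun m => (memOrlicz (s m)).1.sub (memOrlicz (s n)).1) ?_
      (hlim.mono fun x hx => hx.sub_const _)⟩
    filter_upwards [eventually_ge_atTop N] with m hm
    rw [← luxemburgSet_congr Φ (coe_sub (s m) (s n))]
    refine mem_of_norm_lt ?_
    rw [← dist_eq_norm]
    exact hN m hm n hn
  have hmem : MemOrlicz Φ μ h := by
    obtain ⟨N, hN⟩ := hdist 1 one_pos
    have h1 : MemOrlicz Φ μ fun x => h x - (s N : Ω →ₘ[μ] ℂ) x :=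
      memOrlicz_of_mem (hmeas.sub (memOrlicz (s N)).1) (hN N le_rfl)
    refine (h1.add (memOrlicz (s N))).congr (Eventually.of_forall fun x => ?_)
    simp
  refine ⟨mk h hmem, Metric.tendsto_atTop.2 fun ε hε => ?_⟩
  obtain ⟨N, hN⟩ := hdist (ε / 2) (half_pos hε)
  refine ⟨N, fun n hn => lt_of_le_of_lt ?_ (half_lt_self hε)⟩
  rw [dist_comm, dist_eq_norm]
  refine norm_le_of_mem ?_
  have : ((mk h hmem - s n : OrliczSpace Φ μ) : Ω →ₘ[μ] ℂ) =ᵐ[μ]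
      fun x => h x - (s n : Ω →ₘ[μ] ℂ) x := by
    filter_upwards [coe_sub (mk h hmem) (s n), coe_mk hmem] with x h1 h2
    rw [h1, h2]
  rw [luxemburgSet_congr Φ this]
  exact hN n hn

end OrliczSpace

end OrliczLemmas

/-! ### Compactness forces finitely many atoms. -/

/-- A compact operator cannot map a bounded sequence to a separated one. -/
theorem IsCompactOperator.not_separated {E : Type*} [NormedAddCommGroup E] [NormedSpace ℂ E]
    {T : E →L[ℂ] E} (hT : IsCompactOperator T) {f : ℕ → E} (hf : ∀ n, ‖f n‖ ≤ 1) {η : ℝ}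
    (hη : 0 < η) (hsep : ∀ m n, m ≠ n → η ≤ ‖T (f m) - T (f n)‖) : False := by
  obtain ⟨K, hK, hsub⟩ := hT.image_closedBall_subset_compact (f := T.toLinearMap) 1
  obtain ⟨a, -, φ, hφ, ha⟩ := hK.tendsto_subseq (x := fun n => T (f n)) fun n =>
    hsub ⟨f n, by simpa using hf n, rfl⟩
  obtain ⟨N, hN⟩ := Metric.cauchySeq_iff.1 ha.cauchySeq η hη
  have h1 := hN N le_rfl (N + 1) (Nat.le_succ N)
  rw [dist_eq_norm] at h1
  exact absurd (hsep _ _ (hφ (Nat.lt_succ_self N)).ne) (not_le.2 h1)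

section Main

variable {Ω : Type*} {𝒜 : MeasurableSpace Ω} [mΩ : MeasurableSpace Ω] {μ : Measure Ω}
  {Φ Ψ : YoungFunction} {u : Ω → ℂ} {T : OrliczSpace Φ μ →L[ℂ] OrliczSpace Φ μ}

/-- `E M_u` does not enlarge supports beyond `𝒜`-measurable sets. -/
theorem IsCondMul.ae_eq_zero_of_notMem (h𝒜 : 𝒜 ≤ mΩ)
    [SigmaFinite (μ.trim h𝒜)] (hT : IsCondMul 𝒜 u T) {f : OrliczSpace Φ μ} {A : Set Ω}
    (hA : MeasurableSet[𝒜] A) (hf : ∀ᵐ x ∂μ, x ∉ A → (f : Ω →ₘ[μ] ℂ) x = 0) :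
    ∀ᵐ x ∂μ, x ∉ A → (T f : Ω →ₘ[μ] ℂ) x = 0 := by
  have h0 := condE_eq_on h𝒜 μ (f := fun x => u x * (f : Ω →ₘ[μ] ℂ) x) (g := fun _ => 0) hA.compl
    (hf.mono fun x hx hxA => by rw [hx hxA, mul_zero])
  filter_upwards [h0, (hT f).2] with x hx hTx hxA
  rw [hTx, hx hxA, condE_zero]

/-- If every `𝒜`-measurable subset of `N` of positive finite measure carries a function in the unit
ball whose image under the compact operator `E M_u` is not small, then `N` consists of finitely
many atoms. -/
theorem IsCondMul.consistsOfFinitelyManyAtoms (h𝒜 : 𝒜 ≤ mΩ)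
    [SigmaFinite (μ.trim h𝒜)] (hT : IsCondMul 𝒜 u T) (hc : IsCompactOperator T)
    {N : Set Ω} (hN : MeasurableSet[𝒜] N) {η : ℝ} (hη : 0 < η)
    (h : ∀ A ⊆ N, MeasurableSet[𝒜] A → 0 < μ A → μ A < ∞ → ∃ f : OrliczSpace Φ μ,
      (∀ᵐ x ∂μ, x ∉ A → (f : Ω →ₘ[μ] ℂ) x = 0) ∧ ‖f‖ ≤ 1 ∧ η ≤ ‖T f‖) :
    ConsistsOfFinitelyManyAtoms 𝒜 μ N := by
  by_contra hcon
  obtain ⟨A, hA, hd⟩ := exists_disjoint_seq_of_not_consistsOfFinitelyManyAtoms h𝒜 hN hcon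
  choose f hf0 hf1 hfη using fun n => h (A n) (hA n).2.1 (hA n).1 (hA n).2.2.1 (hA n).2.2.2
  -- The images are supported in disjoint sets, so `|T f_m| ≤ |T f_m - T f_n|` a.e. and the norm is
  -- monotone.
  refine hc.not_separated hf1 hη fun m n hmn => (hfη m).trans (OrliczSpace.norm_mono ?_)
  filter_upwards [hT.ae_eq_zero_of_notMem h𝒜 (hA m).1 (hf0 m),
    hT.ae_eq_zero_of_notMem h𝒜 (hA n).1 (hf0 n), OrliczSpace.coe_sub (T (f m)) (T (f n))]
    with x hm hn hsub
  rw [hsub]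
  by_cases hx : x ∈ A m
  · rw [hn (disjoint_left.1 (hd hmn) hx), sub_zero]
  · rw [hm hx, norm_zero]
    exact norm_nonneg _

/-- By locality, `T 1_A = E(u) 1_A` for `A ∈ 𝒜` of finite measure. For `A ⊆ N` this gives `‖T 1_A‖ ≥
ε ‖1_A‖`, so normalized indicators are the test functions. A general `N` covers both sets of part
(a). -/
theorem IsCondMul.consistsOfFinitelyManyAtoms_of_le_norm_condE (h𝒜 : 𝒜 ≤ mΩ)
    [SigmaFinite (μ.trim h𝒜)] (hT : IsCondMul 𝒜 u T)
    (hc : IsCompactOperator T) {N : Set Ω} (hN : MeasurableSet[𝒜] N) {ε : ℝ} (hε : 0 < ε)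
    (hNε : ∀ x ∈ N, ε ≤ ‖condE 𝒜 μ u x‖) : ConsistsOfFinitelyManyAtoms 𝒜 μ N := by
  refine hT.consistsOfFinitelyManyAtoms h𝒜 hc hN hε fun A hAN hA hA0 hAfin => ?_
  have hmem := memOrlicz_indicator_one Φ (h𝒜 _ hA) hAfin
  set e : OrliczSpace Φ μ := OrliczSpace.mk _ hmem with he
  have hecoe : ((e : Ω →ₘ[μ] ℂ) : Ω → ℂ) =ᵐ[μ] A.indicator 1 := OrliczSpace.coe_mk hmem
  have he0 : e ≠ 0 := by
    intro h0
    refine hA0.ne' (measure_eq_zero_iff_ae_notMem.2 ?_)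
    have hz : ((0 : OrliczSpace Φ μ) : Ω →ₘ[μ] ℂ) =ᵐ[μ] (0 : Ω → ℂ) := AEEqFun.coeFn_zero
    rw [h0] at hecoe
    filter_upwards [hecoe, hz] with x h1 h2 hx
    rw [h1, indicator_of_mem hx] at h2
    exact one_ne_zero h2
  have hn : 0 < ‖e‖ := norm_pos_iff.2 he0
  have hTe : ε * ‖e‖ ≤ ‖T e‖ := by
    have : ‖(ε : ℂ) • e‖ ≤ ‖T e‖ := by
      refine OrliczSpace.norm_mono ?_
      have h1 := condE_eq_on h𝒜 μ (f := fun x => u x * (e : Ω →ₘ[μ] ℂ) x) (g := u) hA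
        (hecoe.mono fun x hx hxA => by rw [hx, indicator_of_mem hxA, Pi.one_apply, mul_one])
      filter_upwards [h1, (hT e).2, hecoe, OrliczSpace.coe_smul (ε : ℂ) e] with x h1 h2 h3 h4
      rw [h4, h3, h2]
      by_cases hx : x ∈ A
      · rw [h1 hx, indicator_of_mem hx, Pi.one_apply, mul_one, Complex.norm_real,
          Real.norm_of_nonneg hε.le]
        exact hNε x (hAN hx)
      · simp [hx]
    rwa [norm_smul, Complex.norm_real, Real.norm_of_nonneg hε.le] at this
  refine ⟨((‖e‖⁻¹ : ℝ) : ℂ) • e, ?_, ?_, ?_⟩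
  · filter_upwards [hecoe, OrliczSpace.coe_smul ((‖e‖⁻¹ : ℝ) : ℂ) e] with x h1 h2 hx
    rw [h2, h1, indicator_of_notMem hx, mul_zero]
  · rw [norm_smul, Complex.norm_real, norm_inv, norm_norm, inv_mul_cancel₀ hn.ne']
  · rw [map_smul, norm_smul, Complex.norm_real, norm_inv, norm_norm, le_inv_mul_iff₀ hn, mul_comm]
    exact hTe

/-! ### Test functions under `Δ'`. -/

/-- Where the truncations of `u` have conditional `Ψ`-modular bounded by `δ`, so does `u`. -/
theorem exists_truncation_pos (h𝒜 : 𝒜 ≤ mΩ) [SigmaFinite (μ.trim h𝒜)] (hu : Measurable u)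
    {δ : ℝ} (hδ : 0 < δ) {A : Set Ω} (hA : MeasurableSet[𝒜] A) (hA0 : 0 < μ A) (hAfin : μ A < ∞)
    (h : ∀ x ∈ A, ENNReal.ofReal (2 * δ) ≤ condLExp 𝒜 μ (fun x => Ψ.eval (u x)) x) :
    ∃ k : ℕ, 0 < μ (A ∩ {x | ENNReal.ofReal δ < condLExp 𝒜 μ
      (fun x => Ψ.eval ({x | ‖u x‖ ≤ k}.indicator u x)) x}) := by
  -- If all truncations had conditional modular at most `δ` a.e. on `A`, monotone convergence would
  -- give `∫_A Ψ(u) ≤ δ μ(A)`, against the lower bound `2 δ μ(A)`.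
  by_contra! hcon
  have hk : ∀ k : ℕ, ∫⁻ x in A, Ψ.eval ({x | ‖u x‖ ≤ k}.indicator u x) ∂μ ≤
      ENNReal.ofReal δ * μ A := by
    intro k
    rw [← setLIntegral_condLExp h𝒜 μ _ hA, ← setLIntegral_const]
    refine setLIntegral_mono_ae' (h𝒜 _ hA) ?_
    filter_upwards [measure_eq_zero_iff_ae_notMem.1 (le_antisymm (hcon k) zero_le)] with x hx hxA
    by_contra! hlt
    exact hx ⟨hxA, hlt⟩
  have hm : ∀ k : ℕ, MeasurableSet {x | ‖u x‖ ≤ k} := fun k =>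
    measurableSet_le hu.norm measurable_const
  have hlim : ∫⁻ x in A, Ψ.eval (u x) ∂μ ≤ ENNReal.ofReal δ * μ A := by
    have hsup : ∀ x, Ψ.eval (u x) = ⨆ k : ℕ, Ψ.eval ({x | ‖u x‖ ≤ k}.indicator u x) := by
      intro x
      refine le_antisymm ?_ (iSup_le fun k => Ψ.eval_mono (norm_indicator_le_norm_self _ _))
      obtain ⟨k, hk⟩ := exists_nat_ge ‖u x‖
      refine le_iSup_of_le k ?_
      rw [indicator_of_mem (show x ∈ {x | ‖u x‖ ≤ k} from hk)]
    simp_rw [hsup]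
    rw [lintegral_iSup (f := fun (k : ℕ) x => Ψ.eval ({x | ‖u x‖ ≤ k}.indicator u x))
      (fun k => Ψ.measurable_eval.comp (hu.indicator (hm k)))]
    · exact iSup_le hk
    · refine fun k l hkl x => Ψ.eval_mono ?_
      exact norm_indicator_le_of_subset (fun y (hy : ‖u y‖ ≤ k) =>
        show ‖u y‖ ≤ l from hy.trans (by exact_mod_cast hkl)) _ _
  have hge : ENNReal.ofReal (2 * δ) * μ A ≤ ∫⁻ x in A, Ψ.eval (u x) ∂μ := by
    rw [← setLIntegral_condLExp h𝒜 μ _ hA, ← setLIntegral_const]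
    exact setLIntegral_mono' (h𝒜 _ hA) h
  have := hge.trans hlim
  rw [ENNReal.mul_le_mul_iff_left hA0.ne' hAfin.ne, ENNReal.ofReal_le_ofReal_iff hδ.le] at this
  linarith

/-- The test functions for `Δ'`: on every `𝒜`-measurable set where `E(Ψ(u))` is bounded below there
lives a function in the unit ball whose image under `E M_u` has modular bounded below. -/
theorem IsCondMul.exists_test_function (h𝒜 : 𝒜 ≤ mΩ)
    [SigmaFinite (μ.trim h𝒜)] (hT : IsCondMul 𝒜 u T) (hu : Measurable u)
    (hΨ : Φ.IsComplementary Ψ) {c a δ : ℝ} (hc : 0 < c) (ha : 0 < a) (hδ : 0 < δ)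
    (hΦ : ∀ x y : ℝ, 0 ≤ x → 0 ≤ y → Φ (x * y) ≤ c * Φ x * Φ y)
    (hΦ' : ∀ t q : ℝ, 0 ≤ t → δ ≤ q → a * q * Φ t ≤ Φ (t * q))
    {A : Set Ω} (hA : MeasurableSet[𝒜] A) (hA0 : 0 < μ A) (hAfin : μ A < ∞)
    (h : ∀ x ∈ A, ENNReal.ofReal (2 * δ) ≤ condLExp 𝒜 μ (fun x => Ψ.eval (u x)) x) :
    ∃ f : OrliczSpace Φ μ, (∀ᵐ x ∂μ, x ∉ A → (f : Ω →ₘ[μ] ℂ) x = 0) ∧ ‖f‖ ≤ 1 ∧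
      ENNReal.ofReal (a / c) ≤ ∫⁻ x, Φ.eval ((T f : Ω →ₘ[μ] ℂ) x) ∂μ := by
  -- `E(Ψ(u))` need not be integrable on `A`, or even finite. The truncation makes the integral over
  -- `B` finite and keeps the integrand above `δ` there.
  obtain ⟨k, hk⟩ := exists_truncation_pos h𝒜 (Ψ := Ψ) hu hδ hA hA0 hAfin h
  set v : Ω → ℂ := {x | ‖u x‖ ≤ k}.indicator u with hv
  have hvm : Measurable v := hu.indicator (measurableSet_le hu.norm measurable_const)
  set q : Ω → ℝ≥0∞ := condLExp 𝒜 μ fun x => Ψ.eval (v x) with hq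
  have hqm : Measurable[𝒜] q := measurable_condLExp 𝒜 μ _
  set B : Set Ω := A ∩ {x | ENNReal.ofReal δ < q x} with hB
  have hBm : MeasurableSet[𝒜] B := hA.inter (measurableSet_lt measurable_const hqm)
  have hBfin : μ B < ∞ := (measure_mono inter_subset_left).trans_lt hAfin
  have hint : ∫⁻ x in B, q x ∂μ = ∫⁻ x in B, Ψ.eval (v x) ∂μ := setLIntegral_condLExp h𝒜 μ _ hBm
  have hintfin : ∫⁻ x in B, q x ∂μ ≠ ∞ := by
    rw [hint]
    refine ne_top_of_le_ne_top (b := ENNReal.ofReal (Ψ k) * μ B)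
      (ENNReal.mul_ne_top ENNReal.ofReal_ne_top hBfin.ne) ?_
    rw [← setLIntegral_const]
    refine lintegral_mono fun x => ENNReal.ofReal_le_ofReal (Ψ.mono (norm_nonneg _) ?_)
    by_cases hx : ‖u x‖ ≤ k
    · rwa [hv, indicator_of_mem (show x ∈ {x | ‖u x‖ ≤ k} from hx)]
    · rw [hv, indicator_of_notMem (show x ∉ {x | ‖u x‖ ≤ k} from hx), norm_zero]
      exact Nat.cast_nonneg k
  set I : ℝ := (∫⁻ x in B, q x ∂μ).toReal with hI
  have hI0 : 0 < I := by
    refine ENNReal.toReal_pos (ne_of_gt ?_) hintfin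
    calc 0 < ENNReal.ofReal δ * μ B := ENNReal.mul_pos (by simpa using hδ) hk.ne'
      _ ≤ ∫⁻ x in B, q x ∂μ := by
        rw [← setLIntegral_const]
        exact setLIntegral_mono' (h𝒜 _ hBm) fun x hx => hx.2.le
  -- `Δ'` bounds the modular of the test function by `c Φ(t) I`; this choice of `t` makes that bound
  -- `1`.
  obtain ⟨t, ht⟩ := Φ.exists_eq (t := (c * I)⁻¹) (by positivity)
  have ht0 : (0 : ℝ) ≤ t := t.coe_nonneg
  set F : Ω → ℝ := fun x => (Φ.inv (Ψ.eval (v x))).toReal with hF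
  have hF0 : ∀ x, 0 ≤ F x := fun x => ENNReal.toReal_nonneg
  have hFm : Measurable F :=
    (Φ.measurable_inv.comp (Ψ.measurable_eval.comp hvm)).ennreal_toReal
  have hΦF : ∀ x, Φ (F x) = Ψ ‖v x‖ := fun x => Φ.map_toReal_inv (Ψ.nonneg' _)
  have hFv : ∀ x, Ψ ‖v x‖ ≤ F x * ‖v x‖ := fun x => hΨ.le_mul (hF0 x) (norm_nonneg _) (hΦF x)
  -- The conjugate phase makes `u w` nonnegative, so nothing cancels in `E(u w)`. Where `u = 0` the
  -- quotient is `0` by convention, and the identity for `u w` still holds.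
  set w : Ω → ℂ := B.indicator fun x =>
    ((t * F x : ℝ) : ℂ) * (starRingEnd ℂ (u x) / (‖u x‖ : ℝ)) with hw
  have hwm : Measurable w := by
    refine Measurable.indicator (Measurable.mul ?_ (Measurable.div ?_ ?_)) (h𝒜 _ hBm)
    · exact Complex.measurable_ofReal.comp (hFm.const_mul _)
    · exact Complex.continuous_conj.measurable.comp hu
    · exact Complex.measurable_ofReal.comp hu.norm
  have hwle : ∀ x ∈ B, ‖w x‖ ≤ t * F x := by
    intro x hx
    rw [hw, indicator_of_mem hx, norm_mul, norm_div, Complex.norm_conj, Complex.norm_real,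
      Complex.norm_real, norm_norm, Real.norm_of_nonneg (mul_nonneg ht0 (hF0 x))]
    exact mul_le_of_le_one_right (mul_nonneg ht0 (hF0 x)) (div_self_le_one _)
  have huw : ∀ x, u x * w x = ((B.indicator (fun x => t * (F x * ‖u x‖)) x : ℝ) : ℂ) := by
    intro x
    by_cases hx : x ∈ B
    · rw [hw, indicator_of_mem hx, indicator_of_mem hx]
      rcases eq_or_ne (u x) 0 with h0 | h0
      · simp [h0]
      · have hn : ((‖u x‖ : ℝ) : ℂ) ≠ 0 := by simpa using h0
        have hmc : u x * starRingEnd ℂ (u x) = ((‖u x‖ : ℝ) : ℂ) ^ 2 := Complex.mul_conj' _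
        push_cast
        field_simp
        linear_combination (t : ℂ) * (F x : ℂ) * hmc
    · simp [hw, hx]
  have hmod : 1 ∈ luxemburgSet Φ μ w := by
    refine ⟨one_pos, ?_⟩
    calc ∫⁻ x, Φ.eval (w x / (1 : ℝ)) ∂μ
        ≤ ∫⁻ x, B.indicator (fun x => ENNReal.ofReal (c * Φ t) * Ψ.eval (v x)) x ∂μ := by
          refine lintegral_mono fun x => ?_
          by_cases hx : x ∈ B
          · rw [indicator_of_mem hx, Complex.ofReal_one, div_one, YoungFunction.eval,
              YoungFunction.eval, ← ENNReal.ofReal_mul (mul_nonneg hc.le (Φ.nonneg' _)), ← hΦF]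
            exact ENNReal.ofReal_le_ofReal
              ((Φ.mono (norm_nonneg _) (hwle x hx)).trans (hΦ _ _ ht0 (hF0 x)))
          · simp [hw, hx, Φ.eval_zero]
      _ = ENNReal.ofReal (c * Φ t) * ENNReal.ofReal I := by
          rw [lintegral_indicator (h𝒜 _ hBm), lintegral_const_mul' _ _ ENNReal.ofReal_ne_top,
            ← hint, hI, ENNReal.ofReal_toReal hintfin]
      _ = 1 := by
          rw [← ENNReal.ofReal_mul (mul_nonneg hc.le (Φ.nonneg' _)), ht,
            show c * (c * I)⁻¹ * I = 1 by field_simp, ENNReal.ofReal_one]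
      _ ≤ 1 := le_rfl
  have hmem : MemOrlicz Φ μ w := memOrlicz_of_mem hwm.aestronglyMeasurable hmod
  have hcoe := OrliczSpace.coe_mk hmem
  set f : OrliczSpace Φ μ := OrliczSpace.mk w hmem with hf
  refine ⟨f, ?_, OrliczSpace.norm_le_of_mem (by rwa [luxemburgSet_congr Φ hcoe]), ?_⟩
  · filter_upwards [hcoe] with x hx hxA
    rw [hx, hw, indicator_of_notMem fun hxB => hxA hxB.1]
  have huf : (fun x => u x * (f : Ω →ₘ[μ] ℂ) x) =ᵐ[μ]
      fun x => ((B.indicator (fun x => t * (F x * ‖u x‖)) x : ℝ) : ℂ) := by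
    filter_upwards [hcoe] with x hx
    rw [hx, huw]
  have hB0 : ∀ x, 0 ≤ B.indicator (fun x => (t : ℝ) * (F x * ‖u x‖)) x := fun x =>
    indicator_nonneg (fun x _ => mul_nonneg ht0 (mul_nonneg (hF0 x) (norm_nonneg _))) x
  set s : Ω → ℝ≥0∞ := condLExp 𝒜 μ
    fun x => ENNReal.ofReal (B.indicator (fun x => (t : ℝ) * (F x * ‖u x‖)) x) with hs
  have hTf : ∀ᵐ x ∂μ, (T f : Ω →ₘ[μ] ℂ) x = ((s x).toReal : ℂ) := by
    have h1 := condE_eq_on h𝒜 μ (A := univ) MeasurableSet.univ (huf.mono fun x hx _ => hx)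
    filter_upwards [(hT f).2, h1] with x h2 h3
    rw [h2, h3 (mem_univ x), condE_ofReal μ hB0]
  -- `toReal` sends `∞` to `0` and would destroy the lower bound on `T f`; the conditionability of
  -- `u f` excludes this.
  have hsfin : ∀ᵐ x ∂μ, s x < ∞ := by
    have h1 : (fun x => ‖u x * (f : Ω →ₘ[μ] ℂ) x‖ₑ) =ᵐ[μ]
        fun x => ENNReal.ofReal (B.indicator (fun x => (t : ℝ) * (F x * ‖u x‖)) x) := by
      filter_upwards [huf] with x hx
      rw [hx, ← ofReal_norm, Complex.norm_real, Real.norm_of_nonneg (hB0 x)]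
    filter_upwards [(hT f).1.2, condLExp_congr_ae (mΩ := 𝒜) h1] with x h2 h3
    rwa [hs, ← h3]
  have hsq : ∀ᵐ x ∂μ, x ∈ B → ENNReal.ofReal t * q x ≤ s x := by
    have h1 : condLExp 𝒜 μ (ENNReal.ofReal t • B.indicator fun x => Ψ.eval (v x)) ≤ᵐ[μ] s := by
      refine condLExp_mono (Eventually.of_forall fun x => ?_)
      by_cases hx : x ∈ B
      · simp only [Pi.smul_apply, indicator_of_mem hx, smul_eq_mul, YoungFunction.eval]
        rw [← ENNReal.ofReal_mul ht0]
        refine ENNReal.ofReal_le_ofReal (mul_le_mul_of_nonneg_left ((hFv x).trans ?_) ht0)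
        exact mul_le_mul_of_nonneg_left (norm_indicator_le_norm_self _ _) (hF0 x)
      · simp [hx]
    filter_upwards [h1, condLExp_smul' (mΩ := 𝒜) (P := μ) (B.indicator fun x => Ψ.eval (v x))
      (ENNReal.ofReal_ne_top (r := t)), condLExp_indicator h𝒜 μ (fun x => Ψ.eval (v x)) hBm]
      with x h1 h2 h3 hx
    rw [h2, Pi.smul_apply, h3, indicator_of_mem hx] at h1
    exact h1
  have hqfin : ∀ᵐ x ∂μ, x ∈ B → q x < ∞ := by
    rw [← ae_restrict_iff' (h𝒜 _ hBm)]
    exact ae_lt_top' ((hqm.mono h𝒜 le_rfl).aemeasurable) hintfin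
  -- Since `c Φ(t) I = 1`, the bound `a Φ(t) I` equals `a / c` and no longer depends on `A`.
  -- Pointwise on `B`, `Φ(|T f|) ≥ Φ(t q) ≥ a q Φ(t)` because `q > δ`.
  calc ENNReal.ofReal (a / c) = ENNReal.ofReal (a * Φ t) * ENNReal.ofReal I := by
        rw [← ENNReal.ofReal_mul (mul_nonneg ha.le (Φ.nonneg' _)), ht]
        congr 1
        field_simp
    _ = ∫⁻ x in B, ENNReal.ofReal (a * Φ t) * q x ∂μ := by
        rw [lintegral_const_mul' _ _ ENNReal.ofReal_ne_top, hI, ENNReal.ofReal_toReal hintfin]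
    _ ≤ ∫⁻ x in B, Φ.eval ((T f : Ω →ₘ[μ] ℂ) x) ∂μ := by
        refine setLIntegral_mono_ae' (h𝒜 _ hBm) ?_
        filter_upwards [hTf, hsfin, hsq, hqfin] with x h1 h2 h3 h4 hx
        have hδq : δ ≤ (q x).toReal :=
          (ENNReal.ofReal_le_iff_le_toReal (h4 hx).ne).1 hx.2.le
        have hts : t * (q x).toReal ≤ (s x).toReal := by
          have := ENNReal.toReal_mono h2.ne (h3 hx)
          rwa [ENNReal.toReal_mul, ENNReal.toReal_ofReal ht0] at this
        rw [h1, YoungFunction.eval, Complex.norm_real, Real.norm_of_nonneg ENNReal.toReal_nonneg,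
          ← ENNReal.ofReal_toReal (h4 hx).ne,
          ← ENNReal.ofReal_mul (mul_nonneg ha.le (Φ.nonneg' _))]
        refine ENNReal.ofReal_le_ofReal ?_
        calc a * Φ t * (q x).toReal = a * (q x).toReal * Φ t := by ring
          _ ≤ Φ (t * (q x).toReal) := hΦ' _ _ ht0 hδq
          _ ≤ Φ (s x).toReal :=
            Φ.mono (mul_nonneg ht0 ENNReal.toReal_nonneg) hts
    _ ≤ ∫⁻ x, Φ.eval ((T f : Ω →ₘ[μ] ℂ) x) ∂μ := setLIntegral_le_lintegral _ _

theorem measurableSet_le_invCondYoung (μ : Measure Ω) (Ψ : YoungFunction) (u : Ω → ℂ) (r : ℝ≥0∞) :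
    MeasurableSet[𝒜] {x | r ≤ invCondYoung 𝒜 μ Ψ u x} :=
  measurableSet_le measurable_const (Ψ.measurable_inv.comp (measurable_condLExp 𝒜 μ _))

theorem IsCondMul.consistsOfFinitelyManyAtoms_of_deltaPrime (h𝒜 : 𝒜 ≤ mΩ)
    [SigmaFinite (μ.trim h𝒜)] (hT : IsCondMul 𝒜 u T)
    (hu : Measurable u) (hΨ : Φ.IsComplementary Ψ) (hcpt : IsCompactOperator T)
    (hΦ : Φ.DeltaPrime) {ε : ℝ} (hε : 0 < ε) :
    ConsistsOfFinitelyManyAtoms 𝒜 μ {x | ENNReal.ofReal ε ≤ invCondYoung 𝒜 μ Ψ u x} := by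
  -- On the set in question `E(Ψ(u)) ≥ Ψ ε`; the half leaves the room that the truncation needs.
  have hδ : 0 < Ψ ε / 2 := half_pos (Ψ.pos hε)
  obtain ⟨a, ha, haΦ⟩ := hΦ.exists_mul_le hδ
  obtain ⟨c, hc, hcΦ⟩ := hΦ
  -- The minimum with `1` allows `lintegral_eval_le`; by the half, norm below `η` would force the
  -- modular strictly below `a / c`.
  have hη : 0 < min 1 (a / c) / 2 := by positivity
  refine hT.consistsOfFinitelyManyAtoms h𝒜 hcpt (measurableSet_le_invCondYoung μ Ψ u _) hη
    fun A hAN hA hA0 hAfin => ?_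
  have hlow : ∀ x ∈ A, ENNReal.ofReal (2 * (Ψ ε / 2)) ≤
      condLExp 𝒜 μ (fun x => Ψ.eval (u x)) x := by
    intro x hx
    rw [mul_div_cancel₀ _ two_ne_zero]
    have h1 : ENNReal.ofReal ε ≤ Ψ.inv (condLExp 𝒜 μ (fun x => Ψ.eval (u x)) x) := hAN hx
    have := Ψ.le_inv_iff.1 h1
    rwa [Real.coe_toNNReal _ hε.le] at this
  obtain ⟨f, hf0, hf1, hTf⟩ :=
    hT.exists_test_function h𝒜 hu hΨ hc ha hδ hcΦ haΦ hA hA0 hAfin hlow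
  refine ⟨f, hf0, hf1, ?_⟩
  by_contra! hlt
  have h1 := hTf.trans (OrliczSpace.lintegral_eval_le
    (by linarith [min_le_left 1 (a / c)]) hlt)
  rw [ENNReal.ofReal_le_ofReal_iff hη.le] at h1
  linarith [min_le_right 1 (a / c), hη]


/-! ### Conditional Hölder inequality and finite-rank approximation. -/

theorem invCondYoung_eq_on (h𝒜 : 𝒜 ≤ mΩ) [SigmaFinite (μ.trim h𝒜)] {A : Set Ω}
    (hA : MeasurableSet[𝒜] A) (Ψ : YoungFunction) (u : Ω → ℂ) :
    ∀ᵐ x ∂μ, x ∈ A → invCondYoung 𝒜 μ Ψ (A.indicator u) x = invCondYoung 𝒜 μ Ψ u x := by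
  have h := condLExp_eq_on h𝒜 μ (X := fun x => Ψ.eval (A.indicator u x))
    (Y := fun x => Ψ.eval (u x)) hA
    (Eventually.of_forall fun x hx => by simp only [indicator_of_mem hx])
  filter_upwards [h] with x hx hxA
  rw [invCondYoung, invCondYoung, hx hxA]

/-- The conditional Hölder inequality localizes to the set where `Ψ⁻¹(E(Ψ(u)))` is finite, on which
`u` need not be globally in the Orlicz space. -/
theorem CondHolder.ae_le_of_lt (h𝒜 : 𝒜 ≤ mΩ) [SigmaFinite (μ.trim h𝒜)] (hu : Measurable u)
    {C : ℝ≥0} (hC : ∀ f g : Ω → ℂ, MemOrlicz Φ μ f → MemOrlicz Ψ μ g →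
      ∀ᵐ x ∂μ, condLExp 𝒜 μ (fun x => ‖f x * g x‖ₑ) x ≤
        C * invCondYoung 𝒜 μ Φ f x * invCondYoung 𝒜 μ Ψ g x)
    {f : Ω → ℂ} (hf : MemOrlicz Φ μ f) (ε : ℝ≥0) :
    ∀ᵐ x ∂μ, invCondYoung 𝒜 μ Ψ u x < ε →
      condLExp 𝒜 μ (fun x => ‖u x * f x‖ₑ) x ≤ C * ε * invCondYoung 𝒜 μ Φ f x := by
  have hM : MeasurableSet[𝒜] {x | invCondYoung 𝒜 μ Ψ u x < ε} :=
    measurableSet_lt (Ψ.measurable_inv.comp (measurable_condLExp 𝒜 μ _)) measurable_const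
  -- On such a piece `A`, `E(Ψ(u)) ≤ Ψ ε` and `μ(A) < ∞`, so `1_A u` lies in `L^Ψ` and Hölder
  -- applies to it. Locality returns from `1_A u` to `u`, and countably many pieces suffice.
  have key : ∀ k, ∀ᵐ x ∂μ, x ∈ {x | invCondYoung 𝒜 μ Ψ u x < ε} ∩ spanningSets (μ.trim h𝒜) k →
      condLExp 𝒜 μ (fun x => ‖u x * f x‖ₑ) x ≤ C * ε * invCondYoung 𝒜 μ Φ f x := by
    intro k
    set A := {x | invCondYoung 𝒜 μ Ψ u x < ε} ∩ spanningSets (μ.trim h𝒜) k with hAdef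
    have hA : MeasurableSet[𝒜] A := hM.inter (measurableSet_spanningSets _ _)
    have hAfin : μ A < ∞ := by
      refine (measure_mono inter_subset_right).trans_lt ?_
      rw [← trim_measurableSet_eq h𝒜 (measurableSet_spanningSets _ _)]
      exact measure_spanningSets_lt_top _ _
    have hmem : MemOrlicz Ψ μ (A.indicator u) := by
      refine ⟨(hu.indicator (h𝒜 _ hA)).aestronglyMeasurable, 1, one_pos, ?_⟩
      simp only [Complex.ofReal_one, one_mul]
      rw [Ψ.eval_indicator, lintegral_indicator (h𝒜 _ hA), ← setLIntegral_condLExp h𝒜 μ _ hA]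
      calc ∫⁻ x in A, condLExp 𝒜 μ (fun x => Ψ.eval (u x)) x ∂μ
          ≤ ∫⁻ _ in A, ENNReal.ofReal (Ψ ε) ∂μ :=
            setLIntegral_mono' (h𝒜 _ hA) fun x hx => Ψ.inv_le_iff.1 (le_of_lt hx.1)
        _ = ENNReal.ofReal (Ψ ε) * μ A := setLIntegral_const _ _
        _ < ∞ := ENNReal.mul_lt_top ENNReal.ofReal_lt_top hAfin
    have heq := condLExp_eq_on h𝒜 μ (X := fun x => ‖f x * A.indicator u x‖ₑ)
      (Y := fun x => ‖u x * f x‖ₑ) hA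
      (Eventually.of_forall fun x hx => by simp only [indicator_of_mem hx, mul_comm])
    filter_upwards [hC f _ hf hmem, heq, invCondYoung_eq_on h𝒜 hA Ψ u] with x h1 h2 h3 hx
    rw [h2 hx, h3 hx] at h1
    calc condLExp 𝒜 μ (fun x => ‖u x * f x‖ₑ) x
        ≤ C * invCondYoung 𝒜 μ Φ f x * invCondYoung 𝒜 μ Ψ u x := h1
      _ ≤ C * invCondYoung 𝒜 μ Φ f x * ε := by
        gcongr
        exact le_of_lt hx.1
      _ = C * ε * invCondYoung 𝒜 μ Φ f x := by ring
  filter_upwards [ae_all_iff.2 key] with x hx hxε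
  have hxu : x ∈ ⋃ k, spanningSets (μ.trim h𝒜) k := by
    rw [iUnion_spanningSets]
    exact mem_univ x
  obtain ⟨k, hk⟩ := mem_iUnion.1 hxu
  exact hx k ⟨hxε, hk⟩

/-- For `k > ‖f‖` the function `f / k` has modular at most `1`; then let `k` decrease to `‖f‖`. This
avoids asking whether the infimum is attained, and the case `‖f‖ = 0`. -/
theorem OrliczSpace.opNorm_le_of_modular_le {S : OrliczSpace Φ μ →L[ℂ] OrliczSpace Φ μ} {M : ℝ}
    (hM : 0 ≤ M) (h : ∀ f : OrliczSpace Φ μ, ∫⁻ x, Φ.eval ((f : Ω →ₘ[μ] ℂ) x) ∂μ ≤ 1 → ‖S f‖ ≤ M) :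
    ‖S‖ ≤ M := by
  refine S.opNorm_le_bound hM fun f => ?_
  have key : ∀ k : ℝ, ‖f‖ < k → ‖S f‖ ≤ M * k := by
    intro k hk
    have hmem := mem_of_norm_lt hk
    have hk0 : 0 < k := hmem.1
    have hg := h (((k⁻¹ : ℝ) : ℂ) • f) (by
      refine (lintegral_mono_ae ?_).trans hmem.2
      filter_upwards [coe_smul ((k⁻¹ : ℝ) : ℂ) f] with x hx
      rw [hx, Complex.ofReal_inv, div_eq_inv_mul])
    rwa [map_smul, norm_smul, Complex.norm_real, Real.norm_of_nonneg (inv_nonneg.2 hk0.le),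
      inv_mul_le_iff₀ hk0, mul_comm] at hg
  refine ge_of_tendsto (x := 𝓝[>] ‖f‖) (f := fun k => M * k) ?_
    (eventually_nhdsWithin_of_forall fun k hk => key k hk)
  exact (tendsto_id.const_mul M).mono_left nhdsWithin_le_nhds

/-- Off the set `{ε ≤ Ψ⁻¹(E(Ψ(u)))}` the operator `E M_u` is small. -/
theorem IsCondMul.norm_sub_indicatorCLM_comp_le (h𝒜 : 𝒜 ≤ mΩ) [SigmaFinite (μ.trim h𝒜)]
    (hT : IsCondMul 𝒜 u T) (hu : Measurable u) {C ε : ℝ≥0} (hC0 : 0 < C) (hε : 0 < ε)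
    (hC : ∀ f g : Ω → ℂ, MemOrlicz Φ μ f → MemOrlicz Ψ μ g →
      ∀ᵐ x ∂μ, condLExp 𝒜 μ (fun x => ‖f x * g x‖ₑ) x ≤
        C * invCondYoung 𝒜 μ Φ f x * invCondYoung 𝒜 μ Ψ g x)
    {N : Set Ω} (hN : MeasurableSet N) (hNε : ∀ x ∉ N, invCondYoung 𝒜 μ Ψ u x < ε) :
    ‖T - (OrliczSpace.indicatorCLM Φ μ hN).comp T‖ ≤ 2 * C * ε := by
  have hM : (0 : ℝ) < 2 * C * ε := by positivity
  refine OrliczSpace.opNorm_le_of_modular_le hM.le fun f hf => OrliczSpace.norm_le_of_mem ⟨hM, ?_⟩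
  set p := condLExp 𝒜 μ fun x => Φ.eval ((f : Ω →ₘ[μ] ℂ) x) with hp
  -- It suffices to bound the modular density pointwise by `E(Φ(f))`, whose integral is that of
  -- `Φ(f)`, at most `1`.
  refine le_trans (lintegral_mono_ae ?_) ((lintegral_condLExp h𝒜 μ _).trans_le hf)
  filter_upwards [OrliczSpace.coe_sub (T f) (OrliczSpace.indicatorCLM Φ μ hN (T f)),
    OrliczSpace.coe_indicatorCLM hN (T f), (hT f).2,
    enorm_condE_le (𝒜 := 𝒜) μ (fun x => u x * (f : Ω →ₘ[μ] ℂ) x),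
    CondHolder.ae_le_of_lt h𝒜 hu hC f.2 ε] with x h1 h2 h3 h4 h5
  change Φ.eval (((T f - OrliczSpace.indicatorCLM Φ μ hN (T f) : OrliczSpace Φ μ) :
    Ω →ₘ[μ] ℂ) x / ((2 * C * ε : ℝ) : ℂ)) ≤ _
  rw [h1, h2]
  by_cases hx : x ∈ N
  · simp [hx, Φ.eval_zero]
  rw [indicator_of_notMem hx, sub_zero, h3]
  set z := condE 𝒜 μ (fun x => u x * (f : Ω →ₘ[μ] ℂ) x) x with hz
  have hb : ‖z‖ₑ ≤ ((2 * C * ε : ℝ≥0) : ℝ≥0∞) * Φ.inv (p x) := by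
    refine h4.trans ((mul_le_mul_right (h5 (hNε x hx)) 2).trans (le_of_eq ?_))
    push_cast
    rw [invCondYoung]
    ring
  have hd : ((‖z‖₊ / (2 * C * ε) : ℝ≥0) : ℝ≥0∞) ≤ Φ.inv (p x) := by
    rw [ENNReal.coe_div (by positivity)]
    exact ENNReal.div_le_of_le_mul' hb
  have := Φ.le_inv_iff.1 hd
  rw [YoungFunction.eval, norm_div, Complex.norm_real, Real.norm_of_nonneg hM.le]
  simpa using this

/-- `T f` agrees a.e. with the `𝒜`-measurable `E(u f)`, which is a.e. constant on atoms. So `1_N T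
f` is a combination of the indicators of the atoms, which lie in `L^Φ` because atoms have finite
measure. -/
theorem IsCondMul.finiteDimensional_range (h𝒜 : 𝒜 ≤ mΩ) [SigmaFinite (μ.trim h𝒜)]
    (hT : IsCondMul 𝒜 u T) {N : Set Ω} (hN : MeasurableSet N)
    (hNat : ConsistsOfFinitelyManyAtoms 𝒜 μ N) :
    FiniteDimensional ℂ (LinearMap.range (((OrliczSpace.indicatorCLM Φ μ hN).comp T :
      OrliczSpace Φ μ →L[ℂ] OrliczSpace Φ μ) : OrliczSpace Φ μ →ₗ[ℂ] OrliczSpace Φ μ)) := by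
  obtain ⟨n, A, hA, hd, hNA⟩ := hNat
  have hmem : ∀ i, MemOrlicz Φ μ ((A i).indicator 1) := fun i =>
    memOrlicz_indicator_one Φ (h𝒜 _ (hA i).1) ((hA i).measure_lt_top h𝒜)
  let e : Fin n → OrliczSpace Φ μ := fun i => OrliczSpace.mk _ (hmem i)
  have : FiniteDimensional ℂ (Submodule.span ℂ (range e)) :=
    FiniteDimensional.span_of_finite ℂ (finite_range e)
  refine Submodule.finiteDimensional_of_le (S₂ := Submodule.span ℂ (range e)) ?_
  rintro _ ⟨f, rfl⟩
  choose c hc using fun i => (hA i).exists_ae_eq_const h𝒜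
    (measurable_condE 𝒜 μ fun x => u x * (f : Ω →ₘ[μ] ℂ) x)
  have heq : OrliczSpace.indicatorCLM Φ μ hN (T f) = ∑ i, c i • e i := by
    refine OrliczSpace.ext_ae ?_
    filter_upwards [OrliczSpace.coe_indicatorCLM hN (T f), (hT f).2, ae_all_iff.2 hc,
      OrliczSpace.coe_sum Finset.univ fun i => c i • e i,
      ae_all_iff.2 fun i => OrliczSpace.coe_smul (c i) (e i),
      ae_all_iff.2 fun i => OrliczSpace.coe_mk (hmem i), hNA.mem_iff] with x h1 h2 h3 h4 h5 h6 h7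
    rw [h1, h4]
    simp only [h5]
    simp only [e, h6]
    by_cases hx : x ∈ N
    · obtain ⟨j, hj⟩ := mem_iUnion.1 (h7.1 hx)
      rw [Finset.sum_eq_single j, indicator_of_mem hx, indicator_of_mem hj, h2, h3 j hj,
        Pi.one_apply, mul_one]
      · intro i _ hij
        rw [indicator_of_notMem (disjoint_left.1 (hd hij.symm) hj), mul_zero]
      · exact fun h => absurd (Finset.mem_univ j) h
    · rw [indicator_of_notMem hx, Finset.sum_eq_zero]
      intro i _
      rw [indicator_of_notMem fun hi => hx (h7.2 (mem_iUnion.2 ⟨i, hi⟩)), mul_zero]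
  change OrliczSpace.indicatorCLM Φ μ hN (T f) ∈ _
  rw [heq]
  exact Submodule.sum_mem _ fun i _ =>
    Submodule.smul_mem _ _ (Submodule.subset_span (mem_range_self i))

theorem IsCondMul.mem_closure_finiteRank (h𝒜 : 𝒜 ≤ mΩ) [SigmaFinite (μ.trim h𝒜)]
    (hT : IsCondMul 𝒜 u T) (hu : Measurable u) (hH : CondHolder 𝒜 μ Φ Ψ)
    (h : ∀ ε : ℝ, 0 < ε →
      ConsistsOfFinitelyManyAtoms 𝒜 μ {x | ENNReal.ofReal ε ≤ invCondYoung 𝒜 μ Ψ u x}) :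
    T ∈ closure {S : OrliczSpace Φ μ →L[ℂ] OrliczSpace Φ μ |
      FiniteDimensional ℂ (LinearMap.range (S : OrliczSpace Φ μ →ₗ[ℂ] OrliczSpace Φ μ))} := by
  obtain ⟨C, hC0, hC⟩ := hH
  refine Metric.mem_closure_iff.2 fun r hr => ?_
  obtain ⟨ε, hε, hεr⟩ : ∃ ε : ℝ≥0, 0 < ε ∧ 2 * (C : ℝ) * ε < r := by
    have hC' : (0 : ℝ) < C := hC0
    refine ⟨(r / (4 * C)).toNNReal, Real.toNNReal_pos.2 (by positivity), ?_⟩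
    rw [Real.coe_toNNReal _ (by positivity), show 2 * (C : ℝ) * (r / (4 * C)) = r / 2 by
      field_simp; norm_num]
    exact half_lt_self hr
  have hN : MeasurableSet {x | ENNReal.ofReal ε ≤ invCondYoung 𝒜 μ Ψ u x} :=
    h𝒜 _ (measurableSet_le_invCondYoung μ Ψ u _)
  refine ⟨(OrliczSpace.indicatorCLM Φ μ hN).comp T, hT.finiteDimensional_range h𝒜 hN (h ε hε), ?_⟩
  rw [dist_eq_norm]
  refine (hT.norm_sub_indicatorCLM_comp_le h𝒜 hu hC0 hε hC hN fun x hx => ?_).trans_lt hεr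
  simpa using hx

end Main

/-! ### Norm limits of finite-rank operators, and the theorem. -/

theorem ContinuousLinearMap.isCompactOperator_of_finiteDimensional_range {E : Type*}
    [NormedAddCommGroup E] [NormedSpace ℂ E] (S : E →L[ℂ] E)
    (h : FiniteDimensional ℂ (LinearMap.range (S : E →ₗ[ℂ] E))) : IsCompactOperator S := by
  have : ProperSpace (LinearMap.range (S : E →ₗ[ℂ] E)) := FiniteDimensional.proper ℂ _
  let R : E →L[ℂ] LinearMap.range (S : E →ₗ[ℂ] E) :=
    S.codRestrict _ fun x => LinearMap.mem_range_self _ x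
  have hR : IsCompactOperator R := isCompactOperator_of_locallyCompactSpace_dom R
  exact hR.clm_comp (LinearMap.range (S : E →ₗ[ℂ] E)).subtypeL

/-- Completeness of `E` enters here: it makes the compact operators a norm-closed set, which
contains the finite-rank ones. -/
theorem isCompactOperator_of_mem_closure_finiteRank {E : Type*}
    [NormedAddCommGroup E] [NormedSpace ℂ E] [CompleteSpace E] {T : E →L[ℂ] E}
    (h : T ∈ closure {S : E →L[ℂ] E | FiniteDimensional ℂ (LinearMap.range (S : E →ₗ[ℂ] E))}) :
    IsCompactOperator T :=
  closure_minimal (fun S hS => S.isCompactOperator_of_finiteDimensional_range hS)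
    isClosed_setOfPred_isCompactOperator h

theorem theorem2p3 {Ω : Type*} (𝒜 : MeasurableSpace Ω) [mΩ : MeasurableSpace Ω] (h𝒜 : 𝒜 ≤ mΩ)
    (μ : Measure Ω) [SigmaFinite (μ.trim h𝒜)] (Φ : YoungFunction)
    (u : Ω → ℂ) (hu : Measurable u)
    (T : OrliczSpace Φ μ →L[ℂ] OrliczSpace Φ μ) (hT : IsCondMul 𝒜 u T) :
    (IsCompactOperator T →
      ∀ ε : ℝ, 0 < ε →
        ConsistsOfFinitelyManyAtoms 𝒜 μ {x | ε ≤ ‖condE 𝒜 μ u x‖} ∧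
        ConsistsOfFinitelyManyAtoms 𝒜 μ
          {x | ε ≤ (condE 𝒜 μ u x).re ∧ (condE 𝒜 μ u x).im = 0}) ∧
    ∀ Ψ : YoungFunction, Φ.IsComplementary Ψ →
      (IsCompactOperator T → Φ.DeltaPrime →
        ∀ ε : ℝ, 0 < ε →
          ConsistsOfFinitelyManyAtoms 𝒜 μ {x | ENNReal.ofReal ε ≤ invCondYoung 𝒜 μ Ψ u x}) ∧
      (CondHolder 𝒜 μ Φ Ψ →
        (∀ ε : ℝ, 0 < ε →
          ConsistsOfFinitelyManyAtoms 𝒜 μ {x | ENNReal.ofReal ε ≤ invCondYoung 𝒜 μ Ψ u x}) →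
        IsCompactOperator T ∧
        T ∈ closure {S : OrliczSpace Φ μ →L[ℂ] OrliczSpace Φ μ |
          FiniteDimensional ℂ (LinearMap.range (S : OrliczSpace Φ μ →ₗ[ℂ] OrliczSpace Φ μ))}) := by
  have hE := measurable_condE 𝒜 μ u
  refine ⟨fun hc ε hε => ⟨?_, ?_⟩, fun Ψ hΨ => ⟨fun hc hΦ ε hε => ?_, fun hH h => ?_⟩⟩
  · exact hT.consistsOfFinitelyManyAtoms_of_le_norm_condE h𝒜 hc
      ((measurable_norm.comp hE) measurableSet_Ici) hε fun x hx => hx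
  · have hre : MeasurableSet[𝒜] {x | ε ≤ (condE 𝒜 μ u x).re} :=
      (Complex.measurable_re.comp hE) measurableSet_Ici
    exact hT.consistsOfFinitelyManyAtoms_of_le_norm_condE h𝒜 hc
      (hre.inter ((Complex.measurable_im.comp hE) (measurableSet_singleton 0))) hε
      fun x hx => hx.1.trans (Complex.re_le_norm _)
  · exact hT.consistsOfFinitelyManyAtoms_of_deltaPrime h𝒜 hu hΨ hc hΦ hε
  · have hcl := hT.mem_closure_finiteRank h𝒜 hu hH h
    exact ⟨isCompactOperator_of_mem_closure_finiteRank hcl, hcl⟩
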